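/- **Setting.** Let $X$ be a reduced $n$-dimensional orbifold: a Hausdorff, second countable space with, for each $p\in X$, a uniformizing system $(V_p,G_p,\pi_p)$ of an open neighbourhood $U_p$ of $p$ ($V_p$ a connected smooth $n$-manifold, $G_p$ a finite group acting smoothly and effectively on $V_p$, $\pi_p$ inducing a homeomorphism $V_p/G_p\cong U_p$), such that for $q\in U_p$ the systems at $p$ and $q$ are equivalent at $q$, i.e. some uniformizing system $W$ of a neighbourhood of $q$ has injections into both. An injection $(W,H,\mu)\to(V,G,\pi)$ is a smooth open embedding $\lambda:W\to V$ over $X$, equivariant for a monomorphism $H\to G$ that restricts to an isomorphism between the subgroups acting trivially. Let $\mathcal R\rightrightarrows\mathcal U$ be the associated groupoid: $\mathcal U=\bigsqcup_p V_p$, and $\mathcal R$ is the set of triples $[\lambda_1,w,\lambda_2]$ ($\lambda_1:W\to V_p$, $\lambda_2:W\to V_q$ injections, $w\in W$) modulo the equivalence relation generated by $[\lambda_1\gamma,w',\lambda_2\gamma]=[\lambda_1,\gamma(w'),\lambda_2]$ for injections $\gamma$. Here $s[\lambda_1,w,\lambda_2]=\lambda_1(w)$, $t[\lambda_1,w,\lambda_2]=\lambda_2(w)$,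 $e(x)=[\mathrm{id},x,\mathrm{id}]$, $i[\lambda_1,w,\lambda_2]=[\lambda_2,w,\lambda_1]$, and $m([\lambda_1,w,\lambda_2],[\mu_1,z,\mu_2])=[\lambda_1\nu_1,y,\mu_2\nu_2]$ whenever $\nu_1(y)=w$, $\nu_2(y)=z$ and $\lambda_2\nu_1=\mu_1\nu_2$. The maps $w\mapsto[\lambda_1,w,\lambda_2]$ are the smooth local parametrizations of $\mathcal R$. Let $\Gamma$ be a Lie group and $F$ a non-empty smooth manifold with a smooth effective left $\Gamma$-action (for example $F=\Gamma$ with left translations, or $F=\mathbf R^k$, $\mathbf C^k$ with $\Gamma=GL_k$). A *principal $\Gamma$-bundle over $\mathcal R\rightrightarrows\mathcal U$* is a smooth map $\rho:\mathcal R\to\Gamma$ with $\rho(i(r))=\rho(r)^{-1}$ and $\rho(m(r,r'))=\rho(r')\rho(r)$. Two such, $\rho_1,\rho_2$, are *isomorphic* if there is a smooth $\delta:\mathcal R\to\Gamma$ with $\delta(r)=\delta(e(s(r)))$ and $\delta(i(r))\rho_1(r)=\rho_2(r)\delta(r)$ for all $r$. A *bundle uniformizing system* over $(V,G,\pi)$,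 for a map $pr:E\to X$, consists of a smooth $\rho_{V,G}:V\times G\to\Gamma$ with $\rho_{V,G}(gx,h)\rho_{V,G}(x,g)=\rho_{V,G}(x,hg)$ and a continuous $\tilde\pi:V\times F\to E$ with $pr(\tilde\pi(x,\xi))=\pi(x)$, inducing a homeomorphism from $(V\times F)/G$, for the action $g(x,\xi)=(gx,\rho_{V,G}(x,g)\xi)$, onto $pr^{-1}(\pi(V))$, which is open in $E$. A *bundle injection* between two such systems (over $W$ and over $V$) is an equivariant map over $E$ of the form $(x,\xi)\mapsto(\lambda(x),\theta(x)\xi)$, with $\lambda:W\to V$ an injection and $\theta:W\to\Gamma$ smooth. A *$\Gamma$-orbibundle* over $X$ (with fibre $F$) is a topological space $E$ with a continuous surjection $pr:E\to X$ and a bundle uniformizing system over each $(V_p,G_p,\pi_p)$, such that for $q\in U_p$ the systems at $p$ and $q$ are equivalent at $q$ (one bundle uniformizing system over a neighbourhood of $q$ has bundle injections into both). An *isomorphism* of orbibundles $E\to E'$ is a homeomorphism over $X$ that carries the germ of bundle structures of $E$ at each point of $X$ to the germ of $E'$. **Proposition.** There is a bijection between principal $\Gamma$-bundles $\rho$ over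 $\mathcal R\rightrightarrows\mathcal U$ and $\Gamma$-orbibundles $E$ over $X$ with fibre $F$, where two orbibundles count as equal if a homeomorphism of their total spaces over $X$ identifies their bundle uniformizing systems over all the $(V_p,G_p,\pi_p)$. If $\rho$ corresponds to $E$, then $\rho([\mathrm{id},x,g])=\rho_{V_p,G_p}(x,g)$ for $x\in V_p$, $g\in G_p$, and $\rho([\lambda_1,w,\lambda_2])\,\theta_1(w)=\theta_2(w)$ whenever $\lambda_1,\lambda_2$ lift to bundle injections $(x,\xi)\mapsto(\lambda_j(x),\theta_j(x)\xi)$ from one bundle uniformizing system of $E$. If $\rho$ and $\rho'$ correspond to $E$ and $E'$, then $\rho$ and $\rho'$ are isomorphic if and only if $E$ and $E'$ are isomorphic. -/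

import Mathlib

open scoped Manifold ContDiff
open Topology

namespace Orbi

universe u v w

/-! ### Uniformizing systems and injections -/

/-- An `n`-dimensional uniformizing system `(V, G, π)` of an open connected subset of `X`
(namely of `range π`): `V` is a connected smooth `n`-manifold, `G` is a finite group acting
smoothly on `V`, and the continuous map `π` induces a homeomorphism of `V / G` onto the open
set `range π`. -/
structure UnifSys (n : ℕ) (X : Type u) [TopologicalSpace X] : Type (u + 1) where
  V : Type u
  G : Type u
  [topV : TopologicalSpace V]
  [t2V : T2Space V]
  [secondCountableV : SecondCountableTopology V]
  [connectedV : ConnectedSpace V]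
  [chartedV : ChartedSpace (EuclideanSpace ℝ (Fin n)) V]
  [manifoldV : IsManifold (𝓡 n) ∞ V]
  [groupG : Group G]
  [finiteG : Finite G]
  [actionV : MulAction G V]
  smooth_smul : ∀ g : G, ContMDiff (𝓡 n) (𝓡 n) ∞ (fun x : V => g • x)
  π : V → X
  continuous_π : Continuous π
  π_smul : ∀ (g : G) (x : V), π (g • x) = π x
  isOpenEmbedding_quotient :
    IsOpenEmbedding (Quotient.lift π (fun _ b h => by
      obtain ⟨g, rfl⟩ := h
      exact π_smul g b) : MulAction.orbitRel.Quotient G V → X)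

attribute [instance] UnifSys.topV UnifSys.t2V UnifSys.secondCountableV UnifSys.connectedV
  UnifSys.chartedV UnifSys.manifoldV UnifSys.groupG UnifSys.finiteG UnifSys.actionV

variable {n : ℕ} {X : Type u} [TopologicalSpace X]

/-- The uniformized open set. -/
def UnifSys.U (A : UnifSys n X) : Set X := Set.range A.π

/-- The subgroup of the elements of `G` that act trivially on `V`. -/
def UnifSys.ker (A : UnifSys n X) : Subgroup A.G := (MulAction.toPermHom A.G A.V).ker

/-- An injection `(φ, λ) : (V', G', π') → (V, G, π)`: a monomorphism `λ` that restricts to an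
isomorphism of the kernels of the actions, and a `λ`-equivariant (smooth) open embedding `φ`
over `X`. -/
structure Injection (A B : UnifSys n X) where
  toFun : A.V → B.V
  hom : A.G →* B.G
  hom_injective : Function.Injective hom
  map_ker : A.ker.map hom = B.ker
  isOpenEmbedding : IsOpenEmbedding toFun
  isLocalDiffeomorph : IsLocalDiffeomorph (𝓡 n) (𝓡 n) ∞ toFun
  equivariant : ∀ (g : A.G) (x : A.V), toFun (g • x) = hom g • toFun x
  π_toFun : ∀ x : A.V, B.π (toFun x) = A.π x

namespace Injection

variable {A B C : UnifSys n X}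

/-- The composite `f ∘ h` of two injections. -/
def comp (f : Injection B C) (h : Injection A B) : Injection A C where
  toFun := f.toFun ∘ h.toFun
  hom := f.hom.comp h.hom
  hom_injective := f.hom_injective.comp h.hom_injective
  map_ker := by rw [← Subgroup.map_map, h.map_ker, f.map_ker]
  isOpenEmbedding := f.isOpenEmbedding.comp h.isOpenEmbedding
  isLocalDiffeomorph := fun x =>
    IsLocalDiffeomorphAt.comp (K := 𝓡 n) _ (h.isLocalDiffeomorph x)
      (f.isLocalDiffeomorph (h.toFun x))
  equivariant := fun g x => by simp [h.equivariant, f.equivariant]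
  π_toFun := fun x => by simp [f.π_toFun, h.π_toFun]

/-- The action of a group element `g` as a diffeomorphism. -/
def smulDiffeo (A : UnifSys n X) (g : A.G) : Diffeomorph (𝓡 n) (𝓡 n) A.V A.V ∞ where
  toEquiv := MulAction.toPerm g
  contMDiff_toFun := A.smooth_smul g
  contMDiff_invFun := A.smooth_smul g⁻¹

/-- The injection of `(V, G, π)` into itself given by the action of `g` on `V` and by the
conjugation by `g` on `G`. -/
def act (A : UnifSys n X) (g : A.G) : Injection A A where
  toFun := fun x => g • x
  hom := (MulAut.conj g).toMonoidHom
  hom_injective := (MulAut.conj g).injective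
  map_ker := by
    have hN : A.ker.Normal := MonoidHom.normal_ker _
    ext x
    constructor
    · rintro ⟨y, hy, rfl⟩
      exact hN.conj_mem y hy g
    · intro hx
      exact ⟨g⁻¹ * x * g, by simpa using hN.conj_mem x hx g⁻¹, by simp [mul_assoc]⟩
  isOpenEmbedding := (smulDiffeo A g).toHomeomorph.isOpenEmbedding
  isLocalDiffeomorph := (smulDiffeo A g).isLocalDiffeomorph
  equivariant := fun h x => by simp [smul_smul]
  π_toFun := fun x => A.π_smul g x

/-- The identity injection. -/
def refl (A : UnifSys n X) : Injection A A where
  toFun := id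
  hom := MonoidHom.id _
  hom_injective := Function.injective_id
  map_ker := Subgroup.map_id _
  isOpenEmbedding := IsOpenEmbedding.id
  isLocalDiffeomorph := (Diffeomorph.refl (𝓡 n) A.V ∞).isLocalDiffeomorph
  equivariant := fun _ _ => rfl
  π_toFun := fun _ => rfl

end Injection

/-! ### Orbifolds -/

/-- Two uniformizing systems are equivalent at `p` if they induce one and the same uniformizing
system of a neighbourhood of `p`. -/
def UnifSys.EquivAt (A B : UnifSys n X) (p : X) : Prop :=
  ∃ W : UnifSys n X, p ∈ W.U ∧ Nonempty (Injection W A) ∧ Nonempty (Injection W B)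

/-- An `n`-dimensional orbifold structure `{(V_p, G_p, π_p)}` on `X`. -/
structure Orbifold (n : ℕ) (X : Type u) [TopologicalSpace X] : Type (u + 1) where
  chart : X → UnifSys n X
  mem_chart : ∀ p, p ∈ (chart p).U
  compatible : ∀ p q, q ∈ (chart p).U → (chart p).EquivAt (chart q) q

/-- An orbifold is reduced if the groups of its charts act effectively. -/
def Orbifold.Reduced (O : Orbifold n X) : Prop := ∀ p, (O.chart p).ker = ⊥

/-! ### The groupoid `R ⇉ U` of an orbifold -/

variable (O : Orbifold n X)

/-- The space of objects, the disjoint union of the `V_p`. -/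
abbrev Obj : Type u := Σ p : X, (O.chart p).V

/-- Triples `(λ₁, w, λ₂)`: two injections of a uniformizing system `W` into `V_src` and `V_tgt`,
and a point `w` of `W`. -/
structure Triple : Type (u + 1) where
  src : X
  tgt : X
  W : UnifSys n X
  left : Injection W (O.chart src)
  pt : W.V
  right : Injection W (O.chart tgt)

/-- The basic identification `(λ₁ ∘ γ, w', λ₂ ∘ γ) ∼ (λ₁, γ w', λ₂)`. -/
inductive Triple.Rel : Triple O → Triple O → Prop
  | mk {p q : X} {W W' : UnifSys n X} (l₁ : Injection W (O.chart p))
      (l₂ : Injection W (O.chart q)) (γ : Injection W' W) (w' : W'.V) :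
      Triple.Rel ⟨p, q, W', l₁.comp γ, w', l₂.comp γ⟩ ⟨p, q, W, l₁, γ.toFun w', l₂⟩

/-- The arrows `R`: the triples modulo the equivalence relation generated by `Triple.Rel`. -/
def Arrow : Type (u + 1) := Quot (Triple.Rel O)

namespace Arrow

variable {O}

/-- The arrow `[λ₁, w, λ₂]`. -/
def mk {p q : X} {W : UnifSys n X} (l₁ : Injection W (O.chart p)) (w : W.V)
    (l₂ : Injection W (O.chart q)) : Arrow O :=
  Quot.mk _ ⟨p, q, W, l₁, w, l₂⟩

/-- The source `s [λ₁, w, λ₂] = λ₁ w`. -/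
def s : Arrow O → Obj O :=
  Quot.lift (fun T => ⟨T.src, T.left.toFun T.pt⟩) (by rintro _ _ ⟨l₁, l₂, γ, w'⟩; rfl)

/-- The target `t [λ₁, w, λ₂] = λ₂ w`. -/
def t : Arrow O → Obj O :=
  Quot.lift (fun T => ⟨T.tgt, T.right.toFun T.pt⟩) (by rintro _ _ ⟨l₁, l₂, γ, w'⟩; rfl)

/-- The identity `e x = [id, x, id]`. -/
def e (x : Obj O) : Arrow O :=
  mk (Injection.refl (O.chart x.1)) x.2 (Injection.refl (O.chart x.1))

/-- The inverse `i [λ₁, w, λ₂] = [λ₂, w, λ₁]`. -/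
def i : Arrow O → Arrow O :=
  Quot.map (fun T => ⟨T.tgt, T.src, T.W, T.right, T.pt, T.left⟩)
    (by rintro _ _ ⟨l₁, l₂, γ, w'⟩; exact Triple.Rel.mk l₂ l₁ γ w')

/-- The graph of the multiplication: `IsMul r r' r''` says that `r'' = m (r, r')`, the arrow `r`
followed by the arrow `r'`. Here
`m ([λ₁, w, λ₂], [μ₁, z, μ₂]) = [λ₁ ∘ ν₁, y, μ₂ ∘ ν₂]` for injections `ν₁`, `ν₂` with
`ν₁ y = w`, `ν₂ y = z` and `λ₂ ∘ ν₁ = μ₁ ∘ ν₂`. -/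
inductive IsMul : Arrow O → Arrow O → Arrow O → Prop
  | mk {p q r : X} {W Z Y : UnifSys n X}
      (l₁ : Injection W (O.chart p)) (l₂ : Injection W (O.chart q))
      (m₁ : Injection Z (O.chart q)) (m₂ : Injection Z (O.chart r))
      (ν₁ : Injection Y W) (ν₂ : Injection Y Z) (y : Y.V) (h : l₂.comp ν₁ = m₁.comp ν₂) :
      IsMul (Arrow.mk l₁ (ν₁.toFun y) l₂) (Arrow.mk m₁ (ν₂.toFun y) m₂)
        (Arrow.mk (l₁.comp ν₁) y (m₂.comp ν₂))

end Arrow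

/-! ### Principal bundles over the groupoid -/

section Bundles

variable (𝔤 : Type*) [NormedAddCommGroup 𝔤] [NormedSpace ℝ 𝔤]
variable (Γ : Type v) [TopologicalSpace Γ] [ChartedSpace 𝔤 Γ] [Group Γ]

variable {Γ} in
/-- Smoothness of a map on `R`. The manifold structure of `R`, for which `s` and `t` are étale,
is the one whose local parametrizations are the maps `W → R`, `w ↦ [λ₁, w, λ₂]`. -/
def SmoothOnArrows (f : Arrow O → Γ) : Prop :=
  ∀ (p q : X) (W : UnifSys n X) (l₁ : Injection W (O.chart p)) (l₂ : Injection W (O.chart q)),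
    ContMDiff (𝓡 n) 𝓘(ℝ, 𝔤) ∞ (fun w : W.V => f (Arrow.mk l₁ w l₂))

/-- A principal `Γ`-bundle over `R ⇉ U`, given by a smooth cocycle `ρ : R → Γ`. The arrow
`(r, h)` of `R × Γ ⇉ U × Γ` goes from `(s r, h)` to `(t r, ρ r * h)`, so that the cocycle of a
composite, first `r` and then `r'`, is `ρ r' * ρ r`. -/
@[ext]
structure PrincipalBundle where
  ρ : Arrow O → Γ
  smooth : SmoothOnArrows O 𝔤 ρ
  ρ_inv : ∀ r, ρ r.i = (ρ r)⁻¹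
  ρ_mul : ∀ r r' r'', Arrow.IsMul r r' r'' → ρ r'' = ρ r' * ρ r

variable {O 𝔤 Γ} in
/-- Isomorphism of bundles over `R ⇉ U`: a smooth `δ : R → Γ` such that the maps
`(r, ξ) ↦ (r, δ r * ξ)` of `R × Γ` and `(x, ξ) ↦ (x, δ (e x) * ξ)` of `U × Γ` commute with the
source and target maps. -/
def PrincipalBundle.Isomorphic (P P' : PrincipalBundle O 𝔤 Γ) : Prop :=
  ∃ δ : Arrow O → Γ, SmoothOnArrows O 𝔤 δ ∧ (∀ r, δ r = δ (Arrow.e r.s)) ∧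
    ∀ r, δ r.i * P.ρ r = P'.ρ r * δ r

/-! ### Orbibundles -/

variable (F : Type w) [TopologicalSpace F] [MulAction Γ F]

/-- A uniformizing system `(V × F, G, π̃)` with structure group `Γ` and fibre `F`, over the
uniformizing system `A = (V, G, π)`, for a map `pr : E → X`: the group `G` acts on `V × F` by
`g (x, ξ) = (g x, ρ (x, g) ξ)`, and `π̃` induces a homeomorphism of `(V × F) / G` onto the part
of `E` over `range π`. -/
structure BundleSys {E : Type*} [TopologicalSpace E] (pr : E → X) (A : UnifSys n X) where
  ρ : A.V → A.G → Γ
  smooth_ρ : ∀ g : A.G, ContMDiff (𝓡 n) 𝓘(ℝ, 𝔤) ∞ (fun x : A.V => ρ x g)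
  ρ_mul : ∀ (x : A.V) (g h : A.G), ρ (g • x) h * ρ x g = ρ x (h * g)
  π : A.V × F → E
  continuous_π : Continuous π
  π_smul : ∀ (g : A.G) (x : A.V) (ξ : F), π (g • x, ρ x g • ξ) = π (x, ξ)
  isOpenEmbedding_quotient :
    IsOpenEmbedding (Quot.lift π (fun a b h => by
      obtain ⟨g, rfl⟩ := h
      exact (π_smul g a.1 a.2).symm) :
      Quot (fun a b : A.V × F => ∃ g : A.G, b = (g • a.1, ρ a.1 g • a.2)) → E)
  range_π : Set.range π = pr ⁻¹' A.U
  pr_π : ∀ y : A.V × F, pr (π y) = A.π y.1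

variable {𝔤 Γ F}

/-- An injection of bundle uniformizing systems: the map `(x, ξ) ↦ (λ x, θ x • ξ)`, with `θ`
smooth, lifting an injection `λ` of the underlying systems, equivariant and over `E`. -/
structure BundleInj {E : Type*} [TopologicalSpace E] {pr : E → X} {A B : UnifSys n X}
    (a : BundleSys 𝔤 Γ F pr A) (b : BundleSys 𝔤 Γ F pr B) extends Injection A B where
  θ : A.V → Γ
  smooth_θ : ContMDiff (𝓡 n) 𝓘(ℝ, 𝔤) ∞ θ
  θ_smul : ∀ (g : A.G) (x : A.V), θ (g • x) * a.ρ x g = b.ρ (toFun x) (hom g) * θ x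
  π_lift : ∀ (x : A.V) (ξ : F), b.π (toFun x, θ x • ξ) = a.π (x, ξ)

/-- Two bundle uniformizing systems of `E` are equivalent at `q` if they induce one and the same
bundle uniformizing system over a neighbourhood of `q`. -/
def BundleSys.EquivAt {E : Type*} [TopologicalSpace E] {pr : E → X} {A B : UnifSys n X}
    (a : BundleSys 𝔤 Γ F pr A) (b : BundleSys 𝔤 Γ F pr B) (q : X) : Prop :=
  ∃ (W : UnifSys n X) (c : BundleSys 𝔤 Γ F pr W),
    q ∈ W.U ∧ Nonempty (BundleInj c a) ∧ Nonempty (BundleInj c b)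

variable (𝔤 Γ F)

/-- A `Γ`-orbibundle with fibre `F` over the orbifold: a space `E` over `X` with bundle
uniformizing systems `(V_p × F, G_p, π̃_p)` over the charts of the orbifold that define the same
germs. For `F = Γ` with left translations these are the principal `Γ`-orbibundles, for
`Γ = GL_k` and `F` the space of column vectors they are the orbifold vector bundles. -/
structure Orbibundle where
  E : Type (max u w)
  [topE : TopologicalSpace E]
  pr : E → X
  continuous_pr : Continuous pr
  surjective_pr : Function.Surjective pr
  sys : ∀ p : X, BundleSys 𝔤 Γ F pr (O.chart p)
  compatible : ∀ p q, q ∈ (O.chart p).U → (sys p).EquivAt (sys q) q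

attribute [instance] Orbibundle.topE

variable {O 𝔤 Γ F}

namespace Orbibundle

/-- Isomorphism of orbibundles: a homeomorphism of the total spaces over `X` that carries the
germ of bundle structures of `B` at each point to the germ of `B'`. Here `c'` is the bundle
uniformizing system obtained from `c` by transport along `f`. -/
def Isomorphic (B B' : Orbibundle O 𝔤 Γ F) : Prop :=
  ∃ f : B.E ≃ₜ B'.E, (∀ x, B'.pr (f x) = B.pr x) ∧
    ∀ p : X, ∃ (W : UnifSys n X) (c : BundleSys 𝔤 Γ F B.pr W) (c' : BundleSys 𝔤 Γ F B'.pr W),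
      p ∈ W.U ∧ (∀ x g, c'.ρ x g = c.ρ x g) ∧ (∀ y, c'.π y = f (c.π y)) ∧
        Nonempty (BundleInj c (B.sys p)) ∧ Nonempty (BundleInj c' (B'.sys p))

/-- `B` and `B'` are the same structure up to the names of the points of the total space: a
homeomorphism over `X` identifies the uniformizing systems `(V_p × F, G_p, π̃_p)` of `B` with
those of `B'`. -/
def Same (B B' : Orbibundle O 𝔤 Γ F) : Prop :=
  ∃ f : B.E ≃ₜ B'.E, (∀ x, B'.pr (f x) = B.pr x) ∧
    (∀ p x g, (B'.sys p).ρ x g = (B.sys p).ρ x g) ∧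
      ∀ p y, (B'.sys p).π y = f ((B.sys p).π y)

variable (O 𝔤 Γ F) in
/-- The relation `Same` as a setoid. -/
instance sameSetoid : Setoid (Orbibundle O 𝔤 Γ F) where
  r := Same
  iseqv :=
    { refl := fun B => ⟨Homeomorph.refl _, fun _ => rfl, fun _ _ _ => rfl, fun _ _ => rfl⟩
      symm := by
        rintro B B' ⟨f, h₁, h₂, h₃⟩
        refine ⟨f.symm, fun x => ?_, fun p x g => (h₂ p x g).symm, fun p y => ?_⟩
        · rw [← h₁, f.apply_symm_apply]
        · rw [h₃, f.symm_apply_apply]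
      trans := by
        rintro B B' B'' ⟨f, h₁, h₂, h₃⟩ ⟨f', h₁', h₂', h₃'⟩
        refine ⟨f.trans f', fun x => ?_, fun p x g => ?_, fun p y => ?_⟩
        · rw [Homeomorph.trans_apply, h₁', h₁]
        · rw [h₂', h₂]
        · rw [h₃', h₃, Homeomorph.trans_apply] }

end Orbibundle

/-- The cocycle `ρ` of `P` is the one of the orbibundle `B`: on the arrows given by the group
actions, `ρ [id, x, g]` is the map `ρ_{V_p, G_p} (x, g)` of the bundle uniformizing system, and
on an arrow `[λ₁, w, λ₂]` whose injections lift to bundle injections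
`(w, ξ) ↦ (λⱼ w, θⱼ w • ξ)`, it carries the fibre coordinate `θ₁ w • ξ` to `θ₂ w • ξ`. -/
def Corresponds (P : PrincipalBundle O 𝔤 Γ) (B : Orbibundle O 𝔤 Γ F) : Prop :=
  (∀ (p : X) (x : (O.chart p).V) (g : (O.chart p).G),
    P.ρ (Arrow.mk (Injection.refl (O.chart p)) x (Injection.act (O.chart p) g)) =
      (B.sys p).ρ x g) ∧
  ∀ (p q : X) (W : UnifSys n X) (c : BundleSys 𝔤 Γ F B.pr W)
    (l₁ : BundleInj c (B.sys p)) (l₂ : BundleInj c (B.sys q)) (w : W.V),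
    P.ρ (Arrow.mk l₁.toInjection w l₂.toInjection) * l₁.θ w = l₂.θ w

end Bundles

end Orbi

namespace Orbi

universe u v w

/-! ### Derivatives of smooth maps that agree on an open set -/

section Germs

variable {E : Type*} [NormedAddCommGroup E] [NormedSpace ℝ E]
  {M : Type*} [TopologicalSpace M] [ChartedSpace E M]
  {N : Type*} [TopologicalSpace N] [ChartedSpace E N]

/-! Reduced orbifold charts are rigid. A smooth map of finite order that fixes a point with identity
derivative is the identity nearby (`eventually_eq_self_of_iterate_eq_id`), and connectedness spreads
this over the whole chart. So a chart group element that is trivial to first order at a point is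
trivial. Consequently free points are dense (`dense_free`), and two injections of one system into a
chart differ by a group element (`exists_eq_act_comp`). Density of free points also shows that
injections with a common value have a common refinement (`exists_refinement`).

For bundles this gives uniqueness of coordinate changes. Over a free point no two points of the
fibre are identified in `E`. A fibre coordinate with values in `Γ` is therefore determined there by
faithfulness, and everywhere by continuity (`eq_of_π_eq`). Hence local coordinate changes glue
(`of_locally`), and an identity between them holds once both sides induce the same map to `E`.

Given `E`, any two injections of a system into charts induce isomorphic bundle systems
(`Orbibundle.agree`). The unique coordinate change between them is the value of `ρ` on the arrow,
and uniqueness yields the cocycle laws. Given `ρ`, gluing the products `V_p × F` along the arrows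
gives `E`. Both constructions satisfy `Represents`, which determines `ρ` from `E` (`unique`) and `E`
from `ρ` up to `Same` (`same`). An isomorphism `δ` of cocycles is the coordinate form of an
isomorphism of orbibundles. -/

/-- The maps `f₁` and `f₂` have the same derivative at a limit point of an open set on which they
agree. -/
theorem hasMFDerivAt_of_eqOn_of_mem_closure {f₁ f₂ : M → N}
    (h₁ : ContMDiff 𝓘(ℝ, E) 𝓘(ℝ, E) ∞ f₁) (h₂ : ContMDiff 𝓘(ℝ, E) 𝓘(ℝ, E) ∞ f₂)
    {S : Set M} (hS : IsOpen S) (hf : Set.EqOn f₁ f₂ S) {x : M} (hx : x ∈ closure S)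
    (hfx : f₁ x = f₂ x) {D : E →L[ℝ] E} (hD : HasMFDerivAt 𝓘(ℝ, E) 𝓘(ℝ, E) f₁ x D) :
    HasMFDerivAt 𝓘(ℝ, E) 𝓘(ℝ, E) f₂ x D := by
  set φ := extChartAt 𝓘(ℝ, E) x
  set F₁ : E → E := extChartAt 𝓘(ℝ, E) (f₁ x) ∘ f₁ ∘ φ.symm
  set F₂ : E → E := extChartAt 𝓘(ℝ, E) (f₁ x) ∘ f₂ ∘ φ.symm
  have c₁ : ContDiffAt ℝ ∞ F₁ (φ x) := by
    have := (contMDiffAt_iff.1 (h₁ x)).2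
    rwa [ModelWithCorners.range_eq_univ, contDiffWithinAt_univ] at this
  have c₂ : ContDiffAt ℝ ∞ F₂ (φ x) := by
    have := (contMDiffAt_iff.1 (h₂ x)).2
    rwa [← hfx, ModelWithCorners.range_eq_univ, contDiffWithinAt_univ] at this
  have d₁ : ContinuousAt (fderiv ℝ F₁) (φ x) :=
    (c₁.fderiv_right (m := 0) (by simp)).continuousAt
  have d₂ : ContinuousAt (fderiv ℝ F₂) (φ x) :=
    (c₂.fderiv_right (m := 0) (by simp)).continuousAt
  set T : Set E := φ.target ∩ φ.symm ⁻¹' S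
  have hT : IsOpen T :=
    (continuousOn_extChartAt_symm x).isOpen_inter_preimage (isOpen_extChartAt_target x) hS
  have hTx : φ x ∈ closure T := by
    have h : x ∈ closure (φ.source ∩ S) :=
      (isOpen_extChartAt_source x).inter_closure ⟨mem_extChartAt_source x, hx⟩
    refine closure_mono ?_ (mem_closure_image (continuousAt_extChartAt x) h)
    rintro _ ⟨y, ⟨hy, hyS⟩, rfl⟩
    refine ⟨φ.map_source hy, ?_⟩
    simpa [φ.left_inv hy] using hyS
  have hEq : ∀ y ∈ T, fderiv ℝ F₁ y = fderiv ℝ F₂ y := by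
    intro y hy
    refine Filter.EventuallyEq.fderiv_eq ?_
    filter_upwards [hT.mem_nhds hy] with z hz
    simp only [F₁, F₂, Function.comp]
    rw [hf hz.2]
  -- Both derivatives are continuous at `φ x` and agree on `T`, which has `φ x` as a limit point.
  have key : fderiv ℝ F₁ (φ x) = fderiv ℝ F₂ (φ x) := by
    have : (𝓝[T] (φ x)).NeBot := mem_closure_iff_nhdsWithin_neBot.1 hTx
    refine tendsto_nhds_unique (f := fderiv ℝ F₁) (d₁.mono_left (nhdsWithin_le_nhds (s := T))) ?_
    refine (d₂.mono_left (nhdsWithin_le_nhds (s := T))).congr' ?_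
    filter_upwards [self_mem_nhdsWithin] with y hy using (hEq y hy).symm
  have hD₁ : HasFDerivAt F₁ D (φ x) := by
    have := hD.2
    rw [ModelWithCorners.range_eq_univ] at this
    exact hasFDerivWithinAt_univ.1 this
  refine ⟨(h₂ x).continuousAt, ?_⟩
  have : HasFDerivAt F₂ D (φ x) := by
    rw [← hD₁.fderiv, key]
    exact (c₂.differentiableAt (by simp)).hasFDerivAt
  have h' : writtenInExtChartAt 𝓘(ℝ, E) 𝓘(ℝ, E) x f₂ = F₂ := by
    simp only [writtenInExtChartAt, F₂, hfx]; rfl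
  rw [h']
  exact this.hasFDerivWithinAt

/-- A smooth map of finite order is the identity near a fixed point at which its derivative is
the identity. -/
theorem eventually_eq_self_of_iterate_eq_id [CompleteSpace E] {f : M → M}
    (hf : ContMDiff 𝓘(ℝ, E) 𝓘(ℝ, E) ∞ f) {x : M} (hx : f x = x)
    (hD : HasMFDerivAt 𝓘(ℝ, E) 𝓘(ℝ, E) f x (ContinuousLinearMap.id ℝ E)) {k : ℕ} (hk : 0 < k)
    (hid : f^[k] = id) : ∀ᶠ y in 𝓝 x, f y = y := by
  set φ := extChartAt 𝓘(ℝ, E) x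
  have hx' : ∀ j, f^[j] x = x := fun j => Function.iterate_fixed hx j
  have hs : ∀ j, ContMDiff 𝓘(ℝ, E) 𝓘(ℝ, E) ∞ f^[j] := by
    intro j
    induction j with
    | zero => exact contMDiff_id
    | succ j ih => exact ih.comp hf
  have hDj : ∀ j, HasMFDerivAt 𝓘(ℝ, E) 𝓘(ℝ, E) f^[j] x (ContinuousLinearMap.id ℝ E) := by
    intro j
    induction j with
    | zero => exact hasMFDerivAt_id x
    | succ j ih =>
      have h1 : HasMFDerivAt 𝓘(ℝ, E) 𝓘(ℝ, E) f^[j] (f x) (ContinuousLinearMap.id ℝ E) := by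
        rw [hx]; exact ih
      exact HasMFDerivAt.comp x h1 hD
  have hstrict : ∀ j, HasStrictFDerivAt (φ ∘ f^[j] ∘ φ.symm) (ContinuousLinearMap.id ℝ E) (φ x) := by
    intro j
    have c : ContDiffAt ℝ ∞ (φ ∘ f^[j] ∘ φ.symm) (φ x) := by
      have := (contMDiffAt_iff.1 (hs j x)).2
      rwa [hx' j, ModelWithCorners.range_eq_univ, contDiffWithinAt_univ] at this
    have d : HasFDerivAt (φ ∘ f^[j] ∘ φ.symm) (ContinuousLinearMap.id ℝ E) (φ x) := by
      have := (hDj j).2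
      simp only [writtenInExtChartAt, hx' j, ModelWithCorners.range_eq_univ] at this
      exact hasFDerivWithinAt_univ.1 this
    exact c.hasStrictFDerivAt' d (by simp)
  -- Averaging over the iterates: `k⁻¹ • H` has identity derivative in the chart, hence is injective
  -- near `x` by the inverse function theorem. Since `H` is invariant under `f`, this forces `f y =
  -- y` near `x`.
  set H : M → E := fun y => ∑ j ∈ Finset.range k, φ (f^[j] y)
  have hsum : HasStrictFDerivAt (fun z => (k : ℝ)⁻¹ • H (φ.symm z))
      ((ContinuousLinearEquiv.refl ℝ E : E ≃L[ℝ] E) : E →L[ℝ] E) (φ x) := by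
    have := (HasStrictFDerivAt.fun_sum (u := Finset.range k) fun j _ => hstrict j).const_smul
      (k : ℝ)⁻¹
    have hid : ((ContinuousLinearEquiv.refl ℝ E : E ≃L[ℝ] E) : E →L[ℝ] E) =
        (k : ℝ)⁻¹ • ∑ _j ∈ Finset.range k, ContinuousLinearMap.id ℝ E := by
      ext z
      simp [← Nat.cast_smul_eq_nsmul ℝ, smul_smul, hk.ne']
    rw [hid]
    exact this
  -- A cyclic shift of the sum, valid also where the iterates leave the domain of the chart.
  have hH : ∀ y, H (f y) = H y := by
    intro y
    have h1 := Finset.sum_range_succ (fun j => φ (f^[j] y)) k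
    have h2 := Finset.sum_range_succ' (fun j => φ (f^[j] y)) k
    simp only [hid, id, Function.iterate_zero] at h1 h2
    exact (add_right_cancel (h1.symm.trans h2)).symm
  have hinj : ∃ s ∈ 𝓝 (φ x), Set.InjOn (fun z => (k : ℝ)⁻¹ • H (φ.symm z)) s :=
    ⟨_, (hsum.toOpenPartialHomeomorph _).open_source.mem_nhds hsum.mem_toOpenPartialHomeomorph_source,
      (hsum.toOpenPartialHomeomorph _).injOn⟩
  obtain ⟨s, hs', hinj⟩ := hinj
  have e1 : ∀ᶠ y in 𝓝 x, y ∈ φ.source ∧ φ y ∈ s :=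
    Filter.Eventually.and (extChartAt_source_mem_nhds x) ((continuousAt_extChartAt x) hs')
  have e2 : ∀ᶠ y in 𝓝 x, f y ∈ φ.source ∧ φ (f y) ∈ s := by
    have : Filter.Tendsto f (𝓝 x) (𝓝 x) := by simpa [ContinuousAt, hx] using (hf x).continuousAt
    exact this.eventually e1
  filter_upwards [e1, e2] with y ⟨hy, hys⟩ ⟨hfy, hfys⟩
  refine φ.injOn hfy hy (hinj hfys hys ?_)
  simp only [φ.left_inv hy, φ.left_inv hfy, hH]

end Germs

/-! ### Reduced uniformizing systems -/

section Reduced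

variable {n : ℕ} {X : Type u} [TopologicalSpace X] {A B C : UnifSys n X}

namespace UnifSys

instance (A : UnifSys n X) : ContinuousConstSMul A.G A.V :=
  ⟨fun g => (A.smooth_smul g).continuous⟩

theorem π_eq_iff (A : UnifSys n X) {x y : A.V} : A.π x = A.π y ↔ ∃ g : A.G, g • x = y := by
  constructor
  · intro h
    have := A.isOpenEmbedding_quotient.injective
      (a₁ := Quotient.mk (MulAction.orbitRel A.G A.V) y)
      (a₂ := Quotient.mk (MulAction.orbitRel A.G A.V) x) h.symm
    exact Quotient.exact this
  · rintro ⟨g, rfl⟩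
    exact (A.π_smul g x).symm

theorem isOpenMap_π (A : UnifSys n X) : IsOpenMap A.π :=
  A.isOpenEmbedding_quotient.isOpenMap.comp
    (isOpenMap_quotient_mk'_mul (Γ := A.G) (T := A.V))

theorem eq_one_of_forall_smul_eq (hA : A.ker = ⊥) {g : A.G} (h : ∀ x : A.V, g • x = x) :
    g = 1 := by
  have : g ∈ A.ker := MonoidHom.mem_ker.2 (Equiv.ext h)
  rwa [hA, Subgroup.mem_bot] at this

/-- An element of the group that fixes a point and acts trivially on its tangent space is
trivial. -/
theorem eq_one_of_hasMFDerivAt_id (hA : A.ker = ⊥) {g : A.G} {x : A.V} (hx : g • x = x)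
    (hD : HasMFDerivAt (𝓡 n) (𝓡 n) (fun y : A.V => g • y) x
      (ContinuousLinearMap.id ℝ (EuclideanSpace ℝ (Fin n)))) : g = 1 := by
  have hid : (fun y : A.V => g • y)^[orderOf g] = id := by
    rw [smul_iterate, pow_orderOf_eq_one]
    exact funext fun y => one_smul _ y
  have hpos : 0 < orderOf g := orderOf_pos g
  -- `S` is open by definition. At a limit point the derivative of `g` is still the identity, so the
  -- finite order argument applies again and `S` is closed. Connectedness of `V` finishes.
  set S : Set A.V := {y | ∀ᶠ z in 𝓝 y, g • z = z}
  have hSo : IsOpen S := isOpen_setOfPred_eventually_nhds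
  have hSe : Set.EqOn id (fun y : A.V => g • y) S := fun y hy =>
    (Filter.Eventually.self_of_nhds hy).symm
  have hSc : IsClosed S := by
    refine isClosed_of_closure_subset fun y hy => ?_
    have hfix : id y = g • y :=
      (isClosed_eq continuous_id (continuous_const_smul g)).closure_subset_iff.2 hSe hy
    exact eventually_eq_self_of_iterate_eq_id (A.smooth_smul g) hfix.symm
      (hasMFDerivAt_of_eqOn_of_mem_closure contMDiff_id (A.smooth_smul g) hSo hSe hy hfix
        (hasMFDerivAt_id y)) hpos hid
  have hSu : S = Set.univ := IsClopen.eq_univ ⟨hSc, hSo⟩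
    ⟨x, eventually_eq_self_of_iterate_eq_id (A.smooth_smul g) hx hD hpos hid⟩
  refine eq_one_of_forall_smul_eq hA fun y => ?_
  have hy : y ∈ S := hSu ▸ Set.mem_univ y
  exact Filter.Eventually.self_of_nhds (p := fun z => g • z = z) hy

theorem eq_one_of_eventually_smul_eq (hA : A.ker = ⊥) {g : A.G} {x : A.V}
    (h : ∀ᶠ y in 𝓝 x, g • y = y) : g = 1 :=
  eq_one_of_hasMFDerivAt_id hA h.self_of_nhds
    ((hasMFDerivAt_id x).congr_of_eventuallyEq (by filter_upwards [h] with y hy using hy))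

/-- The points with trivial isotropy group. -/
def free (A : UnifSys n X) : Set A.V := {x | ∀ g : A.G, g • x = x → g = 1}

/-- The fixed set of a non-trivial element is closed, and has empty interior because an element
trivial near a point is trivial. The free locus is the intersection of the finitely many
complements. -/
theorem dense_free (hA : A.ker = ⊥) : Dense A.free := by
  have h : A.free = ⋂ g ∈ {g : A.G | g ≠ 1}, {x : A.V | g • x = x}ᶜ := by
    ext x
    simp only [free, Set.mem_ofPred_eq, Set.mem_iInter, Set.mem_compl_iff]
    exact forall_congr' fun g => not_imp_not.symm
  have := ChartedSpace.locallyCompactSpace (EuclideanSpace ℝ (Fin n)) A.V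
  rw [h]
  refine dense_biInter_of_isOpen (fun g _ => ?_) (Set.to_countable _) fun g hg => ?_
  · exact (isClosed_eq (continuous_const_smul g) continuous_id).isOpen_compl
  · rw [← interior_eq_empty_iff_dense_compl, Set.eq_empty_iff_forall_notMem]
    exact fun x hx => hg (eq_one_of_eventually_smul_eq hA (mem_interior_iff_mem_nhds.1 hx))

end UnifSys

namespace Injection

theorem contMDiff (f : Injection A B) : ContMDiff (𝓡 n) (𝓡 n) ∞ f.toFun :=
  f.isLocalDiffeomorph.contMDiff

theorem continuous (f : Injection A B) : Continuous f.toFun := f.contMDiff.continuous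

theorem ker_eq_bot (f : Injection A B) (hB : B.ker = ⊥) : A.ker = ⊥ :=
  (Subgroup.map_eq_bot_iff_of_injective _ f.hom_injective).1 (f.map_ker.trans hB)

theorem injective (f : Injection A B) : Function.Injective f.toFun := f.isOpenEmbedding.injective

/-- By equivariance, `f.hom g` and `f'.hom g` act alike on the open image of the common map, so they
coincide. Equalities of injections thus reduce to equalities of maps. -/
theorem ext_of_reduced (hB : B.ker = ⊥) {f f' : Injection A B} (h : f.toFun = f'.toFun) :
    f = f' := by
  have hom : f.hom = f'.hom := by
    ext g
    obtain ⟨x⟩ := (inferInstance : Nonempty A.V)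
    refine (inv_mul_eq_one.1 (UnifSys.eq_one_of_eventually_smul_eq hB (x := f.toFun x) ?_)).symm
    have : ∀ᶠ y in 𝓝 (f.toFun x), y ∈ Set.range f.toFun :=
      f.isOpenEmbedding.isOpen_range.mem_nhds ⟨x, rfl⟩
    filter_upwards [this]
    rintro _ ⟨y, rfl⟩
    rw [mul_smul, ← f.equivariant, inv_smul_eq_iff, h, f'.equivariant]
  cases f; cases f'
  simp only at h hom
  subst h hom
  rfl

/-- An element that carries a point of the image of an injection to a point of the image comes from
the smaller group. -/
theorem mem_range_hom (hB : B.ker = ⊥) (f : Injection A B) {g : B.G} {x y : A.V}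
    (h : g • f.toFun x = f.toFun y) : ∃ a : A.G, f.hom a = g ∧ a • x = y := by
  set S : Set A.V := {z | g • f.toFun z ∈ Set.range f.toFun}
  have hS : IsOpen S := f.isOpenEmbedding.isOpen_range.preimage
    ((continuous_const_smul g).comp f.continuous)
  have hfS : IsOpen (f.toFun '' S) := f.isOpenEmbedding.isOpenMap _ hS
  -- Move to a nearby free point `f z`. There `z` and `z'` lie in one orbit of the smaller group,
  -- and freeness turns equality of the translates into equality of the group elements.
  obtain ⟨_, ⟨z, ⟨z', hz'⟩, rfl⟩, hz⟩ := (UnifSys.dense_free hB).inter_open_nonempty _ hfS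
    ⟨_, x, ⟨y, h.symm⟩, rfl⟩
  obtain ⟨a, rfl⟩ : ∃ a : A.G, a • z = z' := by
    rw [← A.π_eq_iff, ← f.π_toFun, ← f.π_toFun, hz', B.π_smul]
  have ha : f.hom a = g := by
    refine (inv_mul_eq_one.1 (hz (g⁻¹ * f.hom a) ?_)).symm
    rw [mul_smul, ← f.equivariant, hz', inv_smul_smul]
  refine ⟨a, ha, f.injective ?_⟩
  rw [f.equivariant, ha, h]

/-- The element `g'⁻¹ * g` fixes `f x`, and its derivative `K` there is the identity on the image of
the derivative of `f`, which is everything. First order rigidity then applies. -/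
theorem eq_of_hasMFDerivAt_smul (hB : B.ker = ⊥) (f : Injection A B) {g g' : B.G} {x : A.V}
    (e : g • f.toFun x = g' • f.toFun x)
    {D : EuclideanSpace ℝ (Fin n) →L[ℝ] EuclideanSpace ℝ (Fin n)}
    (d : HasMFDerivAt (𝓡 n) (𝓡 n) (fun y : A.V => g • f.toFun y) x D)
    (d' : HasMFDerivAt (𝓡 n) (𝓡 n) (fun y : A.V => g' • f.toFun y) x D) : g = g' := by
  have smul_deriv : ∀ (h : B.G) (z : B.V),
      ∃ P : EuclideanSpace ℝ (Fin n) →L[ℝ] EuclideanSpace ℝ (Fin n),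
        HasMFDerivAt (𝓡 n) (𝓡 n) (fun y : B.V => h • y) z P := fun h z =>
    ⟨_, ((B.smooth_smul h).mdifferentiableAt (x := z) (by simp)).hasMFDerivAt⟩
  obtain ⟨P, a'⟩ := smul_deriv g'⁻¹ (g' • f.toFun x)
  have a : HasMFDerivAt (𝓡 n) (𝓡 n) (fun y : B.V => g'⁻¹ • y) (g • f.toFun x) P := by
    rw [e]; exact a'
  obtain ⟨K, c⟩ := smul_deriv (g'⁻¹ * g) (f.toFun x)
  have b' : HasMFDerivAt (𝓡 n) (𝓡 n) f.toFun x (P.comp D) :=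
    (HasMFDerivAt.comp x a' d').congr_of_eventuallyEq
      (Filter.Eventually.of_forall fun y => (inv_smul_smul g' (f.toFun y)).symm)
  have b : HasMFDerivAt (𝓡 n) (𝓡 n) (fun y : A.V => (g'⁻¹ * g) • f.toFun y) x (P.comp D) :=
    (HasMFDerivAt.comp x a d).congr_of_eventuallyEq
      (Filter.Eventually.of_forall fun y => mul_smul _ _ _)
  have hK : K.comp (P.comp D) = P.comp D :=
    hasMFDerivAt_unique (HasMFDerivAt.comp x c b') b
  have hsurj : Function.Surjective (P.comp D) := by
    have h := (f.isLocalDiffeomorph.mfderivToContinuousLinearEquiv (by simp) x).surjective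
    have h' := hasMFDerivAt_unique b' (f.contMDiff.mdifferentiableAt (by simp)).hasMFDerivAt
    intro z
    obtain ⟨y, hy⟩ := h z
    exact ⟨y, (DFunLike.congr_fun h' y).trans hy⟩
  have hKid : K = ContinuousLinearMap.id ℝ (EuclideanSpace ℝ (Fin n)) := by
    refine ContinuousLinearMap.ext fun z => ?_
    obtain ⟨y, rfl⟩ := hsurj z
    exact congrArg (fun T => T y) hK
  refine (inv_mul_eq_one.1 (UnifSys.eq_one_of_hasMFDerivAt_id hB (x := f.toFun x) ?_ ?_)).symm
  · rw [mul_smul, e, inv_smul_smul]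
  · rw [← hKid]; exact c

/-- Two injections of a uniformizing system into a reduced one differ by an element of the
group. -/
theorem exists_eq_act_comp (hB : B.ker = ⊥) (f f' : Injection A B) :
    ∃ g : B.G, f' = (act B g).comp f := by
  -- Finitely many closed sets cover `V`, so by Baire the closures of their interiors still cover
  -- it. These closures are pairwise disjoint: at a common point, `g` and `g'` would have the same
  -- first order behaviour along `f`. By connectedness one of them is all of `V`.
  set C : B.G → Set A.V := fun g => {x | f'.toFun x = g • f.toFun x}
  have hs : ∀ g : B.G, ContMDiff (𝓡 n) (𝓡 n) ∞ (fun x : A.V => g • f.toFun x) := fun g =>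
    (B.smooth_smul g).comp f.contMDiff
  have hC : ∀ g, IsClosed (C g) := fun g => isClosed_eq f'.continuous (hs g).continuous
  have hCU : ⋃ g, C g = Set.univ := by
    refine Set.eq_univ_of_forall fun x => Set.mem_iUnion.2 ?_
    obtain ⟨g, hg⟩ := B.π_eq_iff.1 ((f.π_toFun x).trans (f'.π_toFun x).symm)
    exact ⟨g, hg.symm⟩
  have hsub : ∀ g, closure (interior (C g)) ⊆ C g := fun g =>
    (hC g).closure_subset_iff.2 interior_subset
  have := ChartedSpace.locallyCompactSpace (EuclideanSpace ℝ (Fin n)) A.V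
  have hD : ⋃ g, closure (interior (C g)) = Set.univ := by
    rw [← closure_iUnion_of_finite]
    exact (dense_iUnion_interior_of_closed hC hCU).closure_eq
  have hdis : ∀ g g' x, x ∈ closure (interior (C g)) → x ∈ closure (interior (C g')) → g = g' := by
    intro g g' x hx hx'
    have e : f'.toFun x = g • f.toFun x := hsub g hx
    have e' : f'.toFun x = g' • f.toFun x := hsub g' hx'
    have d0 := (f'.contMDiff.mdifferentiableAt (x := x) (by simp)).hasMFDerivAt
    have d1 := hasMFDerivAt_of_eqOn_of_mem_closure f'.contMDiff (hs g) isOpen_interior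
      (fun y hy => interior_subset (s := C g) hy) hx e d0
    have d2 := hasMFDerivAt_of_eqOn_of_mem_closure f'.contMDiff (hs g') isOpen_interior
      (fun y hy => interior_subset (s := C g') hy) hx' e' d0
    exact eq_of_hasMFDerivAt_smul hB f (e.symm.trans e') d1 d2
  obtain ⟨x⟩ := (inferInstance : Nonempty A.V)
  obtain ⟨g, hg⟩ := Set.mem_iUnion.1 (hD ▸ Set.mem_univ x : x ∈ ⋃ g, closure (interior (C g)))
  have hopen : IsOpen (closure (interior (C g))) := by
    have : closure (interior (C g)) = (⋃ g' ∈ {g' | g' ≠ g}, closure (interior (C g')))ᶜ := by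
      ext y
      simp only [Set.mem_compl_iff, Set.mem_iUnion, not_exists]
      refine ⟨fun hy g' hne hy' => hne (hdis _ _ y hy' hy), fun hy => ?_⟩
      obtain ⟨g', hg'⟩ := Set.mem_iUnion.1 (hD ▸ Set.mem_univ y : y ∈ ⋃ g, closure (interior (C g)))
      by_cases hgg : g' = g
      · exact hgg ▸ hg'
      · exact absurd hg' (hy g' hgg)
    rw [this]
    exact (Set.Finite.isClosed_biUnion (Set.toFinite _) fun _ _ => isClosed_closure).isOpen_compl
  have huniv := IsClopen.eq_univ ⟨isClosed_closure, hopen⟩ ⟨x, hg⟩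
  refine ⟨g, ext_of_reduced hB (funext fun y => ?_)⟩
  exact hsub g (huniv ▸ Set.mem_univ y)

end Injection

end Reduced

/-! ### Restrictions and common refinements of uniformizing systems -/

section Refine

variable {n : ℕ} {X : Type u} [TopologicalSpace X] {A B C : UnifSys n X}

theorem isOpenEmbedding_quot_lift {Y Z : Type*} [TopologicalSpace Y] [TopologicalSpace Z]
    {r : Y → Y → Prop} {f : Y → Z} (hr : ∀ a b, r a b → f a = f b) (hc : Continuous f)
    (ho : IsOpenMap f) (hi : ∀ a b, f a = f b → Quot.mk r a = Quot.mk r b) :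
    IsOpenEmbedding (Quot.lift f hr) := by
  refine .of_continuous_injective_isOpenMap (continuous_quot_lift _ hc) ?_ ?_
  · rintro ⟨a⟩ ⟨b⟩ h
    exact hi a b h
  · intro s hs
    have : Quot.lift f hr '' s = f '' (Quot.mk r ⁻¹' s) := by
      ext z
      constructor
      · rintro ⟨⟨a⟩, ha, rfl⟩
        exact ⟨a, ha, rfl⟩
      · rintro ⟨a, ha, rfl⟩
        exact ⟨Quot.mk r a, ha, rfl⟩
    rw [this]
    exact ho _ (hs.preimage continuous_quot_mk)

/-- The inclusion of an open subset is a local diffeomorphism. -/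
theorem isLocalDiffeomorph_subtype_val {E : Type*} [NormedAddCommGroup E] [NormedSpace ℝ E]
    {M : Type*} [TopologicalSpace M] [ChartedSpace E M] [IsManifold 𝓘(ℝ, E) ∞ M]
    (N : TopologicalSpace.Opens M) :
    IsLocalDiffeomorph 𝓘(ℝ, E) 𝓘(ℝ, E) ∞ (Subtype.val : N → M) := by
  classical
  intro x
  let inv : M → N := fun y => if h : y ∈ N then ⟨y, h⟩ else x
  refine ⟨{ toFun := Subtype.val, invFun := inv, source := Set.univ, target := N,
            map_source' := fun y _ => y.2, map_target' := fun _ _ => Set.mem_univ _,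
            left_inv' := fun y _ => by simp [inv],
            right_inv' := fun y hy => by simp [inv, SetLike.mem_coe.1 hy],
            open_source := isOpen_univ, open_target := N.isOpen,
            contMDiffOn_toFun := contMDiff_subtype_val.contMDiffOn,
            contMDiffOn_invFun := fun y hy => ?_ }, Set.mem_univ _, fun _ _ => rfl⟩
  refine ContMDiffAt.contMDiffWithinAt ((ContMDiffAt.subtypeVal_comp_iff N inv y).1 ?_)
  refine contMDiffAt_id.congr_of_eventuallyEq ?_
  filter_upwards [N.isOpen.mem_nhds hy] with z hz
  simp [inv, SetLike.mem_coe.1 hz]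

/-- The restriction of a uniformizing system to an open connected subset that is invariant under a
subgroup and disjoint from its other translates. -/
noncomputable def UnifSys.restrict (A : UnifSys n X) (N : TopologicalSpace.Opens A.V) (H : Subgroup A.G)
    (hN : IsConnected (N : Set A.V)) (hH : ∀ g ∈ H, ∀ x ∈ N, g • x ∈ N)
    (hsep : ∀ g : A.G, ∀ x ∈ N, g • x ∈ N → g ∈ H) : UnifSys n X :=
  letI : ConnectedSpace N := isConnected_iff_connectedSpace.1 hN
  letI : MulAction H N :=
    { smul := fun g x => ⟨(g : A.G) • (x : A.V), hH g g.2 x x.2⟩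
      one_smul := fun x => Subtype.ext (one_smul A.G (x : A.V))
      mul_smul := fun g h x => Subtype.ext (mul_smul (g : A.G) (h : A.G) (x : A.V)) }
  { V := N
    G := H
    smooth_smul := fun g => (ContMDiff.subtypeVal_comp_iff N _).1
      ((A.smooth_smul (g : A.G)).comp contMDiff_subtype_val)
    π := fun x => A.π x
    continuous_π := A.continuous_π.comp continuous_subtype_val
    π_smul := fun g x => A.π_smul (g : A.G) x
    isOpenEmbedding_quotient := by
      refine isOpenEmbedding_quot_lift _ (A.continuous_π.comp continuous_subtype_val)
        (A.isOpenMap_π.comp N.isOpen.isOpenMap_subtype_val) fun a b h => ?_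
      obtain ⟨g, hg⟩ := A.π_eq_iff.1 h.symm
      exact Quot.sound ⟨⟨g, hsep g b b.2 (hg ▸ a.2)⟩, Subtype.ext hg⟩ }

/-- A reduced uniformizing system has restrictions to arbitrarily small neighbourhoods of each
point. -/
theorem UnifSys.exists_restrict (hA : A.ker = ⊥) {O : Set A.V} (hO : IsOpen O) {x : A.V}
    (hx : x ∈ O) :
    ∃ (W : UnifSys n X) (f : Injection W A), Set.range f.toFun ⊆ O ∧ x ∈ Set.range f.toFun := by
  -- Elements moving `x` are to move a small neighbourhood off itself. Only the stabilizer then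
  -- survives in the restricted system.
  have hV : ∀ g : A.G, ∃ V : Set A.V, IsOpen V ∧ x ∈ V ∧
      (g • x ≠ x → ∀ y ∈ V, g • y ∉ V) := by
    intro g
    by_cases hg : g • x = x
    · exact ⟨Set.univ, isOpen_univ, Set.mem_univ _, fun h => absurd hg h⟩
    · obtain ⟨P, Q, hP, hQ, hPx, hQx, hd⟩ := t2_separation hg
      refine ⟨Q ∩ (fun y => g • y) ⁻¹' P, hQ.inter (hP.preimage (continuous_const_smul g)),
        ⟨hQx, hPx⟩, fun _ y hy hy' => Set.disjoint_left.1 hd hy.2 hy'.1⟩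
  choose V hVo hVx hV using hV
  set Q : Set A.V := O ∩ ⋂ g, V g
  have hQ : IsOpen Q := hO.inter (isOpen_iInter_of_finite hVo)
  set N₀ : Set A.V := ⋂ h : MulAction.stabilizer A.G x, (fun y => (h : A.G) • y) ⁻¹' Q
  have hN₀ : IsOpen N₀ := isOpen_iInter_of_finite fun h =>
    hQ.preimage (continuous_const_smul (h : A.G))
  have hN₀Q : N₀ ⊆ Q := fun y hy => by
    have := Set.mem_iInter.1 hy 1
    simpa using this
  have hxN₀ : x ∈ N₀ := Set.mem_iInter.2 fun h => by
    have : (h : A.G) • x = x := h.2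
    simp only [Set.mem_preimage, this]
    exact ⟨hx, Set.mem_iInter.2 hVx⟩
  have hstab₀ : ∀ g ∈ MulAction.stabilizer A.G x, ∀ y ∈ N₀, g • y ∈ N₀ := by
    intro g hg y hy
    refine Set.mem_iInter.2 fun h => ?_
    have := Set.mem_iInter.1 hy (h * ⟨g, hg⟩)
    simpa [mul_smul] using this
  have : LocallyConnectedSpace A.V :=
    ChartedSpace.locallyConnectedSpace (EuclideanSpace ℝ (Fin n)) A.V
  -- The stabilizer preserves `N₀` and fixes `x`, hence preserves the component of `x`.
  let N : TopologicalSpace.Opens A.V := ⟨connectedComponentIn N₀ x, hN₀.connectedComponentIn⟩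
  have hNN₀ : ∀ y ∈ N, y ∈ N₀ := connectedComponentIn_subset N₀ x
  have hstab : ∀ g ∈ MulAction.stabilizer A.G x, ∀ y ∈ N, g • y ∈ N := by
    intro g hg y hy
    have h1 := (continuous_const_smul g).continuousOn.image_connectedComponentIn_subset hxN₀
      (Set.mem_image_of_mem _ hy)
    simp only [show g • x = x from hg] at h1
    refine connectedComponentIn_mono x ?_ h1
    rintro _ ⟨z, hz, rfl⟩
    exact hstab₀ g hg z hz
  have hsep : ∀ g : A.G, ∀ y ∈ N, g • y ∈ N → g ∈ MulAction.stabilizer A.G x := by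
    intro g y hy hgy
    by_contra hg
    exact hV g hg y (Set.mem_iInter.1 (hN₀Q (hNN₀ y hy)).2 g)
      (Set.mem_iInter.1 (hN₀Q (hNN₀ _ hgy)).2 g)
  have hconn : IsConnected (N : Set A.V) := isConnected_connectedComponentIn_iff.2 hxN₀
  let W := A.restrict N (MulAction.stabilizer A.G x) hconn hstab hsep
  have hW : W.ker = ⊥ := by
    refine (Subgroup.eq_bot_iff_forall _).2 fun g hg => Subtype.ext ?_
    refine UnifSys.eq_one_of_eventually_smul_eq hA (x := x) ?_
    filter_upwards [N.isOpen.mem_nhds (mem_connectedComponentIn hxN₀)] with y hy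
    exact congrArg Subtype.val (Equiv.congr_fun (MonoidHom.mem_ker.1 hg) (⟨y, hy⟩ : N))
  refine ⟨W, {
    toFun := fun y : N => (y : A.V)
    hom := (MulAction.stabilizer A.G x).subtype
    hom_injective := Subtype.val_injective
    map_ker := by rw [hW, hA]; exact Subgroup.map_bot _
    isOpenEmbedding := N.isOpen.isOpenEmbedding_subtypeVal
    isLocalDiffeomorph := isLocalDiffeomorph_subtype_val N
    equivariant := fun g y => rfl
    π_toFun := fun y => rfl }, ?_, ?_⟩
  · rintro _ ⟨y, rfl⟩
    exact (hN₀Q (hNN₀ _ y.2)).1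
  · exact ⟨⟨x, mem_connectedComponentIn hxN₀⟩, rfl⟩

namespace Injection

/-- Injectivity of `f` forces the map, and `mem_range_hom` provides the homomorphism: each `h.hom g`
carries some point of the image of `f` into that image, so it comes from `A.G`. -/
theorem exists_comp_eq (hB : B.ker = ⊥) (f : Injection A B) (h : Injection C B)
    (hr : Set.range h.toFun ⊆ Set.range f.toFun) : ∃ k : Injection C A, f.comp k = h := by
  have hk : ∀ x, ∃ y, f.toFun y = h.toFun x := fun x => hr ⟨x, rfl⟩
  choose k hk using hk
  have hfk : f.toFun ∘ k = h.toFun := funext hk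
  have hrange : ∀ g, h.hom g ∈ f.hom.range := by
    intro g
    obtain ⟨x⟩ := (inferInstance : Nonempty C.V)
    obtain ⟨a, ha, -⟩ := f.mem_range_hom hB (g := h.hom g) (x := k x) (y := k (g • x))
      (by rw [hk, hk, h.equivariant])
    exact ⟨a, ha⟩
  let φ : C.G →* A.G := (MonoidHom.ofInjective f.hom_injective).symm.toMonoidHom.comp
    (h.hom.codRestrict f.hom.range hrange)
  have hφ : ∀ g, f.hom (φ g) = h.hom g := fun g =>
    congrArg Subtype.val ((MonoidHom.ofInjective f.hom_injective).apply_symm_apply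
      (h.hom.codRestrict f.hom.range hrange g))
  have hkl : IsLocalDiffeomorph (𝓡 n) (𝓡 n) ∞ k := by
    intro x
    obtain ⟨Φ, hΦx, hΦ⟩ := h.isLocalDiffeomorph x
    obtain ⟨Ψ, hΨx, hΨ⟩ := f.isLocalDiffeomorph (k x)
    refine ⟨Φ.trans Ψ.symm, ⟨hΦx, ?_⟩, ?_⟩
    · change Φ x ∈ Ψ.target
      rw [← hΦ hΦx, ← hk, hΨ hΨx]
      exact Ψ.map_source hΨx
    · rintro y ⟨hy, hy'⟩
      change k y = Ψ.symm (Φ y)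
      refine f.injective ?_
      have h1 : Φ y ∈ Ψ.target := hy'
      rw [hk, hΦ hy]
      exact ((hΨ (Ψ.map_target h1)).trans (Ψ.right_inv h1)).symm
  refine ⟨{
    toFun := k
    hom := φ
    hom_injective := fun a b hab => h.hom_injective (by rw [← hφ, ← hφ, hab])
    map_ker := by rw [h.ker_eq_bot hB, f.ker_eq_bot hB]; exact Subgroup.map_bot _
    isOpenEmbedding := .of_comp k f.isOpenEmbedding (hfk ▸ h.isOpenEmbedding)
    isLocalDiffeomorph := hkl
    equivariant := fun g x => f.injective (by rw [hk, f.equivariant, hφ, hk, h.equivariant])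
    π_toFun := fun x => by rw [← f.π_toFun, hk, h.π_toFun] }, ?_⟩
  exact ext_of_reduced hB hfk

/-- Two injections into a reduced uniformizing system have a common refinement near a common
value. -/
theorem exists_refinement (hC : C.ker = ⊥) (f : Injection A C) (h : Injection B C) {a : A.V}
    {b : B.V} (hab : f.toFun a = h.toFun b) :
    ∃ (Y : UnifSys n X) (f' : Injection Y A) (h' : Injection Y B) (y : Y.V),
      f.comp f' = h.comp h' ∧ f'.toFun y = a ∧ h'.toFun y = b := by
  obtain ⟨Y, k, hk, y, hy⟩ := UnifSys.exists_restrict hC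
    (f.isOpenEmbedding.isOpen_range.inter h.isOpenEmbedding.isOpen_range)
    (x := f.toFun a) ⟨⟨a, rfl⟩, ⟨b, hab.symm⟩⟩
  obtain ⟨f', hf'⟩ := exists_comp_eq hC f k (hk.trans Set.inter_subset_left)
  obtain ⟨h', hh'⟩ := exists_comp_eq hC h k (hk.trans Set.inter_subset_right)
  refine ⟨Y, f', h', y, hf'.trans hh'.symm, f.injective ?_, h.injective ?_⟩
  · rw [← hy, ← hf']; rfl
  · rw [← hab, ← hy, ← hh']; rfl

/-- Points over the same point of `X` may have different images in `C.V`. These images lie in one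
orbit, so a group element reduces to the case of a common value. -/
theorem exists_refinement_act (hC : C.ker = ⊥) (f : Injection A C) (h : Injection B C) {a : A.V}
    {b : B.V} (hab : A.π a = B.π b) :
    ∃ (Y : UnifSys n X) (f' : Injection Y A) (h' : Injection Y B) (y : Y.V) (g : C.G),
      f.comp f' = (act C g).comp (h.comp h') ∧ f'.toFun y = a ∧ h'.toFun y = b := by
  rw [← f.π_toFun, ← h.π_toFun] at hab
  obtain ⟨g, hg⟩ := C.π_eq_iff.1 hab.symm
  obtain ⟨Y, f', h', y, e, ha, hb⟩ := exists_refinement hC f ((act C g).comp h) hg.symm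
  exact ⟨Y, f', h', y, g, e, ha, hb⟩

end Injection

end Refine

/-! ### Comparison of bundle uniformizing systems -/

section Compare

variable {n : ℕ} {X : Type u} [TopologicalSpace X] {A B C W Y : UnifSys n X}
variable {𝔤 : Type*} [NormedAddCommGroup 𝔤] [NormedSpace ℝ 𝔤]
variable {Γ : Type v} [TopologicalSpace Γ] [ChartedSpace 𝔤 Γ] [Group Γ]
variable {F : Type w} [TopologicalSpace F] [MulAction Γ F]
variable {E E' : Type*} [TopologicalSpace E] [TopologicalSpace E'] {pr : E → X} {pr' : E' → X}

namespace BundleSys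

theorem ρ_one (b : BundleSys 𝔤 Γ F pr B) (x : B.V) : b.ρ x 1 = 1 := by
  have := b.ρ_mul x 1 1
  rwa [one_smul, mul_one, mul_eq_right] at this

theorem π_eq_iff (b : BundleSys 𝔤 Γ F pr B) {x y : B.V} {ξ η : F} :
    b.π (x, ξ) = b.π (y, η) ↔ ∃ g : B.G, y = g • x ∧ η = b.ρ x g • ξ := by
  constructor
  · intro h
    have h' := b.isOpenEmbedding_quotient.injective (a₁ := Quot.mk _ (x, ξ))
      (a₂ := Quot.mk _ (y, η)) h
    -- The cocycle identity makes the generating relation an equivalence already, so equality in the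
    -- quotient is witnessed by a single group element.
    have heq : Equivalence
        (fun a b' : B.V × F => ∃ g : B.G, b' = (g • a.1, b.ρ a.1 g • a.2)) := by
      refine ⟨fun a => ⟨1, by simp [b.ρ_one]⟩, ?_, ?_⟩
      · rintro a _ ⟨g, rfl⟩
        refine ⟨g⁻¹, ?_⟩
        have := b.ρ_mul a.1 g g⁻¹
        simp [smul_smul, this, b.ρ_one]
      · rintro a _ _ ⟨g, rfl⟩ ⟨h, rfl⟩
        exact ⟨h * g, by simp [smul_smul, b.ρ_mul]⟩
    obtain ⟨g, hg⟩ := heq.eqvGen_iff.1 (Quot.eq.1 h')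
    exact ⟨g, congrArg Prod.fst hg, congrArg Prod.snd hg⟩
  · rintro ⟨g, rfl, rfl⟩
    exact (b.π_smul g x ξ).symm

/-- The saturation of an open set is the union of its preimages under the continuous action maps of
`G` on `V × F`. -/
theorem isOpenMap_π [ContinuousSMul Γ F] (b : BundleSys 𝔤 Γ F pr B) : IsOpenMap b.π := by
  refine b.isOpenEmbedding_quotient.isOpenMap.comp (f := Quot.mk _) fun s hs => ?_
  refine isOpen_coinduced.2 ?_
  have : (Quot.mk (fun a b' : B.V × F => ∃ g : B.G, b' = (g • a.1, b.ρ a.1 g • a.2))) ⁻¹'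
      (Quot.mk _ '' s) = ⋃ g : B.G, (fun y : B.V × F => (g • y.1, b.ρ y.1 g • y.2)) ⁻¹' s := by
    ext y
    simp only [Set.mem_preimage, Set.mem_image, Set.mem_iUnion]
    constructor
    · rintro ⟨z, hz, hzy⟩
      have h : b.π y = b.π z := congrArg (Quot.lift b.π fun a a' h => by
        obtain ⟨g, rfl⟩ := h
        exact (b.π_smul g a.1 a.2).symm) hzy.symm
      obtain ⟨g, h1, h2⟩ := b.π_eq_iff.1 h
      refine ⟨g, ?_⟩
      rw [← h1, ← h2]
      exact hz
    · rintro ⟨g, hg⟩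
      exact ⟨_, hg, (Quot.sound ⟨g, rfl⟩).symm⟩
  rw [this]
  refine isOpen_iUnion fun g => hs.preimage ?_
  exact ((continuous_const_smul g).comp continuous_fst).prodMk
    (((b.smooth_ρ g).continuous.comp continuous_fst).smul continuous_snd)

/-- A fibrewise map into a reduced bundle uniformizing system determines its fibre component. -/
theorem eq_of_π_eq [T2Space Γ] [FaithfulSMul Γ F] (hB : B.ker = ⊥) (b : BundleSys 𝔤 Γ F pr B)
    (m : Injection W B) {θ θ' : W.V → Γ} (hθ : Continuous θ) (hθ' : Continuous θ')
    (h : ∀ x (ξ : F), b.π (m.toFun x, θ x • ξ) = b.π (m.toFun x, θ' x • ξ)) : θ = θ' := by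
  -- It suffices to compare over the preimage of the free locus, which is dense because `m` is open.
  -- There the group element relating the two fibre points must be `1`.
  refine Continuous.ext_on ((B.dense_free hB).preimage m.isOpenEmbedding.isOpenMap) hθ hθ' ?_
  intro x hx
  refine eq_of_smul_eq_smul (α := F) fun ξ => ?_
  obtain ⟨g, h1, h2⟩ := b.π_eq_iff.1 (h x ξ)
  rw [hx g h1.symm, b.ρ_one, one_smul] at h2
  exact h2.symm

/-- The transport of a bundle uniformizing system along a homeomorphism over the base. -/
def map (c : BundleSys 𝔤 Γ F pr B) (f : E ≃ₜ E') (hf : ∀ x, pr' (f x) = pr x) :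
    BundleSys 𝔤 Γ F pr' B where
  ρ := c.ρ
  smooth_ρ := c.smooth_ρ
  ρ_mul := c.ρ_mul
  π := f ∘ c.π
  continuous_π := f.continuous.comp c.continuous_π
  π_smul g x ξ := congrArg f (c.π_smul g x ξ)
  isOpenEmbedding_quotient := by
    have := f.isOpenEmbedding.comp c.isOpenEmbedding_quotient
    convert this using 1
    ext ⟨a⟩
    rfl
  range_π := by
    ext y
    rw [Set.range_comp, c.range_π]
    simp only [Set.mem_image, Set.mem_preimage]
    exact ⟨fun ⟨x, hx, hxy⟩ => by rwa [← hxy, hf], fun h =>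
      ⟨f.symm y, by rwa [← hf, f.apply_symm_apply], f.apply_symm_apply y⟩⟩
  pr_π y := (hf _).trans (c.pr_π y)

/-- The bundle uniformizing systems `a` and `b` induce isomorphic systems along the injections `l`
and `m`. -/
def Agree (a : BundleSys 𝔤 Γ F pr A) (b : BundleSys 𝔤 Γ F pr B) (l : Injection W A)
    (m : Injection W B) : Prop :=
  ∃ θ : W.V → Γ, ContMDiff (𝓡 n) 𝓘(ℝ, 𝔤) ∞ θ ∧
    ∀ x (ξ : F), b.π (m.toFun x, θ x • ξ) = a.π (l.toFun x, ξ)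

namespace Agree

variable {a : BundleSys 𝔤 Γ F pr A} {b : BundleSys 𝔤 Γ F pr B} {c : BundleSys 𝔤 Γ F pr C}
  {l : Injection W A} {m : Injection W B} {k : Injection W C}

theorem symm [LieGroup 𝓘(ℝ, 𝔤) ∞ Γ] (h : Agree a b l m) : Agree b a m l := by
  obtain ⟨θ, hθ, h⟩ := h
  refine ⟨fun x => (θ x)⁻¹, hθ.inv, fun x ξ => ?_⟩
  rw [← h, smul_inv_smul]

theorem trans [LieGroup 𝓘(ℝ, 𝔤) ∞ Γ] (h : Agree a b l m) (h' : Agree b c m k) :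
    Agree a c l k := by
  obtain ⟨θ, hθ, h⟩ := h
  obtain ⟨θ', hθ', h'⟩ := h'
  refine ⟨fun x => θ' x * θ x, hθ'.mul hθ, fun x ξ => ?_⟩
  rw [mul_smul, h', h]

theorem comp (h : Agree a b l m) (f : Injection Y W) : Agree a b (l.comp f) (m.comp f) := by
  obtain ⟨θ, hθ, h⟩ := h
  exact ⟨θ ∘ f.toFun, hθ.comp f.contMDiff, fun x ξ => h (f.toFun x) ξ⟩

theorem map (h : Agree a b l m) (f : E ≃ₜ E') (hf : ∀ x, pr' (f x) = pr x) :
    Agree (a.map f hf) (b.map f hf) l m := by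
  obtain ⟨θ, hθ, h⟩ := h
  exact ⟨θ, hθ, fun x ξ => congrArg f (h x ξ)⟩

theorem of_bundleInj (f : BundleInj a b) (l : Injection W A) :
    Agree a b l (f.toInjection.comp l) :=
  ⟨f.θ ∘ l.toFun, f.smooth_θ.comp l.contMDiff, fun x ξ => f.π_lift (l.toFun x) ξ⟩

theorem act_comp (b : BundleSys 𝔤 Γ F pr B) (m : Injection W B) (g : B.G) :
    Agree b b m ((Injection.act B g).comp m) :=
  ⟨fun x => b.ρ (m.toFun x) g, (b.smooth_ρ g).comp m.contMDiff,
    fun x ξ => b.π_smul g (m.toFun x) ξ⟩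

/-- The injections differ by some `g`, and the action of `g` on `V × F` supplies the coordinate
change `b.ρ (m.toFun x) g`. -/
theorem of_reduced (hB : B.ker = ⊥) (b : BundleSys 𝔤 Γ F pr B) (m m' : Injection W B) :
    Agree b b m m' := by
  obtain ⟨g, rfl⟩ := Injection.exists_eq_act_comp hB m m'
  exact act_comp b m g

theorem of_locally [LieGroup 𝓘(ℝ, 𝔤) ∞ Γ] [T2Space Γ] [FaithfulSMul Γ F] (hB : B.ker = ⊥)
    (h : ∀ x : W.V, ∃ (Y : UnifSys n X) (f : Injection Y W) (y : Y.V), f.toFun y = x ∧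
      Agree a b (l.comp f) (m.comp f)) : Agree a b l m := by
  choose Y f y hy θ hθ h using h
  have hW : W.ker = ⊥ := m.ker_eq_bot hB
  -- The local coordinate changes agree on overlaps: on a common refinement both induce the same map
  -- to `E`, so uniqueness applies.
  have key : ∀ x (z : (Y x).V), θ ((f x).toFun z) (y _) = θ x z := by
    intro x z
    obtain ⟨Z, f₁, f₂, z', e, e₁, e₂⟩ := Injection.exists_refinement hW (f ((f x).toFun z)) (f x)
      (a := y _) (b := z) (hy _)
    have e' : ∀ t, (f ((f x).toFun z)).toFun (f₁.toFun t) = (f x).toFun (f₂.toFun t) := fun t =>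
      congrFun (congrArg Injection.toFun e) t
    have := b.eq_of_π_eq hB ((m.comp (f x)).comp f₂) (θ := θ ((f x).toFun z) ∘ f₁.toFun)
      (θ' := θ x ∘ f₂.toFun) ((hθ _).continuous.comp f₁.continuous)
      ((hθ _).continuous.comp f₂.continuous) fun t ξ => by
        have h1 := h ((f x).toFun z) (f₁.toFun t) ξ
        have h2 := h x (f₂.toFun t) ξ
        simp only [Injection.comp, Function.comp, e'] at h1 h2 ⊢
        rw [h1, h2]
    have hz := congrFun this z'
    rw [Function.comp, Function.comp, e₁, e₂] at hz
    exact hz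
  refine ⟨fun x => θ x (y x), fun x => ?_, fun x ξ => ?_⟩
  -- Near `x`, the glued function is the smooth `θ x` read through a local inverse of `f x`.
  · have hl := (f x).isLocalDiffeomorph (y x)
    have hs : ContMDiffAt (𝓡 n) 𝓘(ℝ, 𝔤) ∞ (θ x ∘ hl.localInverse) ((f x).toFun (y x)) :=
      (hθ x _).comp _ hl.localInverse_contMDiffAt
    rw [hy] at hs
    refine hs.congr_of_eventuallyEq ?_
    have := hl.localInverse_eventuallyEq_right
    rw [hy] at this
    filter_upwards [this] with z hz
    have hz' : (f x).toFun (hl.localInverse z) = z := hz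
    have hk := key x (hl.localInverse z)
    rw [hz'] at hk
    exact hk
  · have := h x (y x) ξ
    simp only [Injection.comp, Function.comp, hy] at this
    exact this

end Agree

end BundleSys

end Compare

section

variable {n : ℕ} {X : Type u} [TopologicalSpace X] {O : Orbifold n X}
variable {𝔤 : Type*} [NormedAddCommGroup 𝔤] [NormedSpace ℝ 𝔤]
variable {Γ : Type v} [TopologicalSpace Γ] [T2Space Γ] [ChartedSpace 𝔤 Γ] [Group Γ]
  [LieGroup 𝓘(ℝ, 𝔤) ∞ Γ]
variable {F : Type w} [TopologicalSpace F] [MulAction Γ F] [FaithfulSMul Γ F]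

open BundleSys

/-- The bundle uniformizing systems of an orbibundle agree along injections. -/
theorem Orbibundle.agree (hO : O.Reduced) (B : Orbibundle O 𝔤 Γ F) {p q : X} {W : UnifSys n X}
    (l : Injection W (O.chart p)) (m : Injection W (O.chart q)) :
    Agree (B.sys p) (B.sys q) l m := by
  refine Agree.of_locally (hO q) fun x => ?_
  -- Compatibility compares the system at `p` with the one at the base point `W.π x`, but through
  -- some injection `i` unrelated to `l`. A common refinement up to a group element transfers the
  -- comparison to `l`.
  have aux : ∀ (p : X) (l : Injection W (O.chart p)), ∃ (Y : UnifSys n X) (f : Injection Y W)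
      (y : Y.V) (k : Injection Y (O.chart (W.π x))), f.toFun y = x ∧
        Agree (B.sys p) (B.sys (W.π x)) (l.comp f) k := by
    intro p l
    have hx : W.π x ∈ (O.chart p).U := ⟨l.toFun x, l.π_toFun x⟩
    obtain ⟨Z, c, ⟨z, hz⟩, ⟨i⟩, ⟨j⟩⟩ := B.compatible p (W.π x) hx
    obtain ⟨Y, f, h, y, g, e, hy, -⟩ := Injection.exists_refinement_act (hO p) l i.toInjection
      (a := x) (b := z) hz.symm
    refine ⟨Y, f, y, j.toInjection.comp h, hy, ?_⟩
    rw [e]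
    exact (Agree.act_comp (B.sys p) (i.toInjection.comp h) g).symm.trans
      ((Agree.of_bundleInj i h).symm.trans (Agree.of_bundleInj j h))
  obtain ⟨Y₁, f₁, y₁, k₁, h₁, a₁⟩ := aux p l
  obtain ⟨Y₂, f₂, y₂, k₂, h₂, a₂⟩ := aux q m
  obtain ⟨Y, i₁, i₂, y, e, e₁, -⟩ := Injection.exists_refinement (l.ker_eq_bot (hO p)) f₁ f₂
    (h₁.trans h₂.symm)
  refine ⟨Y, f₁.comp i₁, y, ?_, ?_⟩
  · rw [← h₁, ← e₁]; rfl
  · have b₁ : Agree (B.sys p) (B.sys (W.π x)) (l.comp (f₁.comp i₁)) (k₁.comp i₁) := a₁.comp i₁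
    have b₂ : Agree (B.sys q) (B.sys (W.π x)) (m.comp (f₂.comp i₂)) (k₂.comp i₂) := a₂.comp i₂
    rw [← e] at b₂
    -- The two resulting injections into the chart at `W.π x` need not coincide; `of_reduced`
    -- bridges them.
    exact b₁.trans ((Agree.of_reduced (hO _) (B.sys (W.π x)) _ _).trans b₂.symm)

end

/-! ### Pullbacks and lifts of injections -/

section Pullback

variable {n : ℕ} {X : Type u} [TopologicalSpace X] {A B C W Y : UnifSys n X}
variable {𝔤 : Type*} [NormedAddCommGroup 𝔤] [NormedSpace ℝ 𝔤]
variable {Γ : Type v} [TopologicalSpace Γ] [ChartedSpace 𝔤 Γ] [Group Γ]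
variable {F : Type w} [TopologicalSpace F] [MulAction Γ F]
variable {E : Type*} [TopologicalSpace E] {pr : E → X}

/-- The pullback of a bundle uniformizing system along an injection. -/
def BundleSys.pullback [ContinuousSMul Γ F] (hB : B.ker = ⊥) (b : BundleSys 𝔤 Γ F pr B)
    (m : Injection W B) : BundleSys 𝔤 Γ F pr W where
  ρ x g := b.ρ (m.toFun x) (m.hom g)
  smooth_ρ g := (b.smooth_ρ (m.hom g)).comp m.contMDiff
  ρ_mul x g h := by rw [m.equivariant, b.ρ_mul, map_mul]
  π y := b.π (m.toFun y.1, y.2)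
  continuous_π := b.continuous_π.comp (m.continuous.prodMap continuous_id)
  π_smul g x ξ := by
    simp only [m.equivariant]
    exact b.π_smul _ _ _
  isOpenEmbedding_quotient := by
    refine isOpenEmbedding_quot_lift _ (b.continuous_π.comp (m.continuous.prodMap continuous_id))
      (b.isOpenMap_π.comp (m.isOpenEmbedding.isOpenMap.prodMap IsOpenMap.id)) ?_
    rintro ⟨x, ξ⟩ ⟨y, η⟩ h
    obtain ⟨g, h1, h2⟩ := b.π_eq_iff.1 h
    -- The larger group makes no extra identifications over the image of `m`.
    obtain ⟨a, rfl, rfl⟩ := m.mem_range_hom hB h1.symm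
    exact Quot.sound ⟨a, Prod.ext rfl h2⟩
  range_π := by
    ext e
    constructor
    · rintro ⟨y, rfl⟩
      exact ⟨y.1, by rw [b.pr_π, m.π_toFun]⟩
    · rintro ⟨x, hx⟩
      have he : e ∈ pr ⁻¹' B.U := ⟨m.toFun x, (m.π_toFun x).trans hx⟩
      rw [← b.range_π] at he
      obtain ⟨⟨y, η⟩, rfl⟩ := he
      rw [b.pr_π, ← m.π_toFun] at hx
      obtain ⟨g, hg⟩ := B.π_eq_iff.1 hx.symm
      refine ⟨(x, b.ρ y g • η), ?_⟩
      change b.π (m.toFun x, b.ρ y g • η) = _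
      rw [← hg]
      exact b.π_smul g y η
  pr_π y := by rw [b.pr_π, m.π_toFun]

/-- Over a reduced uniformizing system, a lift of an injection is equivariant. -/
def BundleInj.ofReduced [T2Space Γ] [LieGroup 𝓘(ℝ, 𝔤) ∞ Γ] [FaithfulSMul Γ F] (hB : B.ker = ⊥)
    {c : BundleSys 𝔤 Γ F pr W} {b : BundleSys 𝔤 Γ F pr B} (m : Injection W B) (θ : W.V → Γ)
    (hθ : ContMDiff (𝓡 n) 𝓘(ℝ, 𝔤) ∞ θ)
    (h : ∀ x (ξ : F), b.π (m.toFun x, θ x • ξ) = c.π (x, ξ)) : BundleInj c b where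
  toInjection := m
  θ := θ
  smooth_θ := hθ
  θ_smul g := by
    -- Both sides are fibre coordinates, over `x ↦ m (g • x)`, of the same map to `E`.
    refine congrFun (b.eq_of_π_eq hB (m.comp (Injection.act W g))
      (θ := fun x => θ (g • x) * c.ρ x g) (θ' := fun x => b.ρ (m.toFun x) (m.hom g) * θ x) ?_ ?_
      fun x ξ => ?_)
    · exact ((hθ.comp (W.smooth_smul g)).mul (c.smooth_ρ g)).continuous
    · exact (((b.smooth_ρ (m.hom g)).comp m.contMDiff).mul hθ).continuous
    · change b.π (m.toFun (g • x), _) = b.π (m.toFun (g • x), _)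
      rw [mul_smul, h, c.π_smul, m.equivariant, mul_smul, b.π_smul, h]
  π_lift := h

end Pullback

/-! ### Arrows -/

section Arrows

variable {n : ℕ} {X : Type u} [TopologicalSpace X] {O : Orbifold n X}

/-- Compatibility relates both charts to the chart at the common image in `X`. After moving by group
elements, a refinement there joins `x` to `y`. -/
theorem exists_arrow (hO : O.Reduced) {p q : X} {x : (O.chart p).V} {y : (O.chart q).V}
    (h : (O.chart p).π x = (O.chart q).π y) :
    ∃ (W : UnifSys n X) (l : Injection W (O.chart p)) (m : Injection W (O.chart q)) (w : W.V),
      l.toFun w = x ∧ m.toFun w = y := by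
  have aux : ∀ (p z : X) (x : (O.chart p).V), (O.chart p).π x = z →
      ∃ (W : UnifSys n X) (l : Injection W (O.chart p)) (_ : Injection W (O.chart z)) (w : W.V),
        l.toFun w = x := by
    rintro p z x rfl
    obtain ⟨W, ⟨w, hw⟩, ⟨l⟩, ⟨m⟩⟩ := O.compatible p _ ⟨x, rfl⟩
    obtain ⟨g, hg⟩ := (O.chart p).π_eq_iff.1 ((l.π_toFun w).trans hw)
    exact ⟨W, (Injection.act _ g).comp l, m, w, hg⟩
  obtain ⟨W, l, k, w, hw⟩ := aux p _ x rfl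
  obtain ⟨W', m, k', w', hw'⟩ := aux q _ y h.symm
  have hww : W.π w = W'.π w' := by
    rw [← l.π_toFun, ← m.π_toFun, hw, hw', h]
  obtain ⟨Z, i, j, z, -, -, hi, hj⟩ := Injection.exists_refinement_act (hO _) k k' hww
  exact ⟨Z, l.comp i, m.comp j, z, by rw [← hw, ← hi]; rfl, by rw [← hw', ← hj]; rfl⟩

theorem Injection.act_comp_act {A : UnifSys n X} (hA : A.ker = ⊥) (g h : A.G) :
    (act A h).comp (act A g) = act A (h * g) :=
  ext_of_reduced hA (funext fun x => smul_smul h g x)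

namespace Arrow

theorem mk_comp {p q : X} {W Y : UnifSys n X} (l : Injection W (O.chart p))
    (m : Injection W (O.chart q)) (f : Injection Y W) (y : Y.V) :
    mk (l.comp f) y (m.comp f) = mk l (f.toFun y) m :=
  Quot.sound (Triple.Rel.mk l m f y)

theorem mk_eq_act {p : X} {W : UnifSys n X} (l : Injection W (O.chart p)) (g : (O.chart p).G)
    (w : W.V) : mk l w ((Injection.act _ g).comp l) =
      mk (Injection.refl _) (l.toFun w) (Injection.act _ g) :=
  mk_comp (Injection.refl _) (Injection.act _ g) l w

theorem isMul_act (hO : O.Reduced) {p : X} (x : (O.chart p).V) (g h : (O.chart p).G) :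
    IsMul (mk (Injection.refl _) x (Injection.act _ g))
      (mk (Injection.refl _) (g • x) (Injection.act _ h))
      (mk (O := O) (Injection.refl _) x (Injection.act _ (h * g))) := by
  rw [← Injection.act_comp_act (hO p)]
  exact IsMul.mk (Injection.refl _) (Injection.act _ g) (Injection.refl _) (Injection.act _ h)
    (Injection.refl _) (Injection.act _ g) x rfl

end Arrow

variable {𝔤 : Type*} [NormedAddCommGroup 𝔤] [NormedSpace ℝ 𝔤]
variable {Γ : Type v} [TopologicalSpace Γ] [ChartedSpace 𝔤 Γ] [Group Γ]

theorem PrincipalBundle.ρ_e (P : PrincipalBundle O 𝔤 Γ) (x : Obj O) : P.ρ (Arrow.e x) = 1 := by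
  have h : Arrow.IsMul (Arrow.e x) (Arrow.e x) (Arrow.e x) :=
    Arrow.IsMul.mk (Injection.refl _) (Injection.refl _) (Injection.refl _) (Injection.refl _)
      (Injection.refl _) (Injection.refl _) x.2 rfl
  have := P.ρ_mul _ _ _ h
  rwa [left_eq_mul] at this

end Arrows

/-! ### The orbibundle of a cocycle -/

namespace PrincipalBundle

variable {n : ℕ} {X : Type u} [TopologicalSpace X] {O : Orbifold n X}
variable {𝔤 : Type*} [NormedAddCommGroup 𝔤] [NormedSpace ℝ 𝔤]
variable {Γ : Type v} [TopologicalSpace Γ] [ChartedSpace 𝔤 Γ] [Group Γ]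
variable (F : Type w) [MulAction Γ F]

variable (O) in
/-- The disjoint union of the products `V_p × F`. -/
abbrev PreTotal : Type (max u w) := Σ p : X, (O.chart p).V × F

variable {F} in
/-- The identification of points of the products `V_p × F` along the arrows. -/
def TotalRel (P : PrincipalBundle O 𝔤 Γ) (a b : PreTotal O F) : Prop :=
  ∃ (W : UnifSys n X) (l : Injection W (O.chart a.1)) (m : Injection W (O.chart b.1)) (w : W.V),
    l.toFun w = a.2.1 ∧ m.toFun w = b.2.1 ∧ b.2.2 = P.ρ (Arrow.mk l w m) • a.2.2

/-- The total space as a quotient of the disjoint union of the products `V_p × F`. -/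
def totalSetoid (hO : O.Reduced) (P : PrincipalBundle O 𝔤 Γ) : Setoid (PreTotal O F) where
  r := P.TotalRel
  iseqv := by
    refine ⟨?_, ?_, ?_⟩
    · rintro ⟨p, x, ξ⟩
      refine ⟨_, Injection.refl _, Injection.refl _, x, rfl, rfl, ?_⟩
      exact ((congrArg (· • ξ) (P.ρ_e ⟨p, x⟩)).trans (one_smul _ ξ)).symm
    · rintro a b ⟨W, l, m, w, hl, hm, h⟩
      refine ⟨W, m, l, w, hm, hl, ?_⟩
      have := P.ρ_inv (Arrow.mk l w m)
      rw [h, show Arrow.mk m w l = (Arrow.mk l w m).i from rfl, this, inv_smul_smul]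
    · rintro a b c ⟨W, l, m, w, hl, hm, h⟩ ⟨Z, l', m', z, hl', hm', h'⟩
      -- Refining at the middle point composes the two arrows; the multiplicativity of `ρ` then
      -- gives transitivity.
      obtain ⟨Y, i, j, y, e, hi, hj⟩ := Injection.exists_refinement (hO b.1) m l'
        (hm.trans hl'.symm)
      have hmul := P.ρ_mul _ _ _ (Arrow.IsMul.mk l m l' m' i j y e)
      refine ⟨Y, l.comp i, m'.comp j, y, ?_, ?_, ?_⟩
      · rw [← hl, ← hi]; rfl
      · rw [← hm', ← hj]; rfl
      · rw [hmul, mul_smul, hi, hj, ← h, h']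

/-- The total space of the orbibundle of a cocycle. -/
abbrev Total (hO : O.Reduced) (P : PrincipalBundle O 𝔤 Γ) : Type (max u w) :=
  Quotient (P.totalSetoid F hO)

variable {F} (hO : O.Reduced) (P : PrincipalBundle O 𝔤 Γ)

/-- The projection of the total space to the base. -/
def totalPr : P.Total F hO → X :=
  Quotient.lift (fun a : PreTotal O F => (O.chart a.1).π a.2.1) (by
    rintro a b ⟨W, l, m, w, hl, hm, -⟩
    simp only [← hl, ← hm, l.π_toFun, m.π_toFun])

/-- The map of `V_p × F` to the total space. -/
def totalπ (p : X) (y : (O.chart p).V × F) : P.Total F hO :=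
  Quotient.mk _ ⟨p, y⟩

theorem totalπ_eq_iff {p q : X} {x : (O.chart p).V} {y : (O.chart q).V} {ξ η : F} :
    P.totalπ hO p (x, ξ) = P.totalπ hO q (y, η) ↔
      P.TotalRel ⟨p, x, ξ⟩ ⟨q, y, η⟩ := Quotient.eq

theorem totalπ_smul {p q : X} {W : UnifSys n X} (l : Injection W (O.chart p))
    (m : Injection W (O.chart q)) (w : W.V) (ξ : F) :
    P.totalπ hO q (m.toFun w, P.ρ (Arrow.mk l w m) • ξ) = P.totalπ hO p (l.toFun w, ξ) :=
  ((P.totalπ_eq_iff hO).2 ⟨W, l, m, w, rfl, rfl, rfl⟩).symm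

variable [TopologicalSpace F]

theorem continuous_totalπ (p : X) : Continuous (P.totalπ hO p : (O.chart p).V × F → _) :=
  continuous_quot_mk.comp continuous_sigmaMk

theorem continuous_totalPr : Continuous (P.totalPr hO : P.Total F hO → X) :=
  continuous_quot_lift _ (continuous_sigma fun p =>
    (O.chart p).continuous_π.comp continuous_fst)

/-- Near a point of another product identified with a point of `s`, an arrow extends to a family
over `W`. Transporting back along this family by `f` shows that all nearby points are also
identified with points of `s`. -/
theorem isOpenMap_totalπ [LieGroup 𝓘(ℝ, 𝔤) ∞ Γ] [ContinuousSMul Γ F] (p : X) :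
    IsOpenMap (P.totalπ hO p : (O.chart p).V × F → _) := by
  intro s hs
  refine isOpen_coinduced.2 (isOpen_sigma_iff.2 fun q => isOpen_iff_mem_nhds.2 ?_)
  rintro ⟨y, η⟩ ⟨⟨x, ξ⟩, hx, hxy⟩
  obtain ⟨W, l, m, w, hl, hm, h⟩ := (P.totalπ_eq_iff hO).1 hxy
  simp only at l m hl hm h
  have hsm : ContMDiff (𝓡 n) 𝓘(ℝ, 𝔤) ∞ fun x => P.ρ (Arrow.mk l x m) := P.smooth p q W l m
  let f : W.V × F → (O.chart p).V × F := fun z =>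
    (l.toFun z.1, (P.ρ (Arrow.mk l z.1 m))⁻¹ • z.2)
  have hf : Continuous f := (l.continuous.comp continuous_fst).prodMk
    ((hsm.inv.continuous.comp continuous_fst).smul continuous_snd)
  have hopen : IsOpen (Prod.map m.toFun id '' (f ⁻¹' s)) :=
    (m.isOpenEmbedding.isOpenMap.prodMap IsOpenMap.id) _ (hs.preimage hf)
  refine Filter.mem_of_superset (hopen.mem_nhds ⟨(w, η), ?_, Prod.ext hm rfl⟩) ?_
  · simp only [Set.mem_preimage, f, h, inv_smul_smul, hl]
    exact hx
  · rintro _ ⟨⟨w', η'⟩, hw', rfl⟩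
    refine ⟨_, hw', (P.totalπ_eq_iff hO).2 ⟨W, l, m, w', rfl, rfl, ?_⟩⟩
    simp

/-- The bundle uniformizing systems of the orbibundle of a cocycle. -/
def totalSys [LieGroup 𝓘(ℝ, 𝔤) ∞ Γ] [ContinuousSMul Γ F] (p : X) :
    BundleSys 𝔤 Γ F (P.totalPr hO : P.Total F hO → X) (O.chart p) where
  ρ x g := P.ρ (Arrow.mk (Injection.refl _) x (Injection.act _ g))
  smooth_ρ g := P.smooth p p _ (Injection.refl _) (Injection.act _ g)
  ρ_mul x g h := (P.ρ_mul _ _ _ (Arrow.isMul_act hO x g h)).symm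
  π := P.totalπ hO p
  continuous_π := P.continuous_totalπ hO p
  π_smul g x ξ := P.totalπ_smul hO (Injection.refl _) (Injection.act _ g) x ξ
  isOpenEmbedding_quotient := by
    refine isOpenEmbedding_quot_lift _ (P.continuous_totalπ hO p) (P.isOpenMap_totalπ hO p) ?_
    rintro ⟨x, ξ⟩ ⟨y, η⟩ h
    obtain ⟨W, l, m, w, hl, hm, h⟩ := (P.totalπ_eq_iff hO).1 h
    simp only at l m hl hm h
    -- An arrow from a chart to itself comes from its group, so within one product the gluing is
    -- exactly the orbit relation.
    obtain ⟨g, rfl⟩ := Injection.exists_eq_act_comp (hO p) l m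
    rw [Arrow.mk_eq_act, hl] at h
    exact Quot.sound ⟨g, Prod.ext (hm.symm.trans (congrArg (g • ·) hl)) h⟩
  range_π := by
    ext e
    constructor
    · rintro ⟨y, rfl⟩
      exact ⟨y.1, rfl⟩
    · obtain ⟨⟨q, y, η⟩, rfl⟩ := Quotient.exists_rep e
      rintro ⟨x, hx⟩
      obtain ⟨W, l, m, w, hl, hm⟩ := exists_arrow hO
        (show (O.chart q).π y = (O.chart p).π x from hx.symm)
      exact ⟨(x, P.ρ (Arrow.mk l w m) • η),
        ((P.totalπ_eq_iff hO).2 ⟨W, l, m, w, hl, hm, rfl⟩).symm⟩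
  pr_π y := rfl

/-- The orbibundle of a cocycle. -/
def orbibundle [T2Space Γ] [LieGroup 𝓘(ℝ, 𝔤) ∞ Γ] [ContinuousSMul Γ F] [FaithfulSMul Γ F]
    [Nonempty F] : Orbibundle O 𝔤 Γ F where
  E := P.Total F hO
  pr := P.totalPr hO
  continuous_pr := P.continuous_totalPr hO
  surjective_pr p := by
    obtain ⟨x, hx⟩ := O.mem_chart p
    obtain ⟨ξ⟩ := (inferInstance : Nonempty F)
    exact ⟨P.totalπ hO p (x, ξ), hx⟩
  sys := P.totalSys hO
  compatible p q hq := by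
    obtain ⟨W, hW, ⟨l⟩, ⟨m⟩⟩ := O.compatible p q hq
    -- The common system is pulled back from `p`: its coordinate change is `1` towards `p` and the
    -- cocycle towards `q`.
    refine ⟨W, (P.totalSys hO p).pullback (hO p) l, hW,
      ⟨.ofReduced (hO p) l (fun _ => 1) contMDiff_const fun x ξ => ?_⟩,
      ⟨.ofReduced (hO q) m (fun x => P.ρ (Arrow.mk l x m)) (P.smooth p q W l m) fun x ξ => ?_⟩⟩
    · rw [one_smul]; rfl
    · exact P.totalπ_smul hO l m x ξ

end PrincipalBundle

/-! ### Cocycles as coordinate changes of orbibundles -/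

section Represents

open BundleSys

variable {n : ℕ} {X : Type u} [TopologicalSpace X] {O : Orbifold n X}
variable {𝔤 : Type*} [NormedAddCommGroup 𝔤] [NormedSpace ℝ 𝔤]
variable {Γ : Type v} [TopologicalSpace Γ] [ChartedSpace 𝔤 Γ] [Group Γ]
variable {F : Type w} [TopologicalSpace F] [MulAction Γ F]

/-- The values of the cocycle `P` are the coordinate changes between the bundle uniformizing systems
of `B`. -/
def Represents (P : PrincipalBundle O 𝔤 Γ) (B : Orbibundle O 𝔤 Γ F) : Prop :=
  ∀ (p q : X) (W : UnifSys n X) (l : Injection W (O.chart p)) (m : Injection W (O.chart q))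
    (w : W.V) (ξ : F),
    (B.sys q).π (m.toFun w, P.ρ (Arrow.mk l w m) • ξ) = (B.sys p).π (l.toFun w, ξ)

theorem PrincipalBundle.represents_orbibundle [T2Space Γ] [LieGroup 𝓘(ℝ, 𝔤) ∞ Γ]
    [ContinuousSMul Γ F] [FaithfulSMul Γ F] [Nonempty F] (hO : O.Reduced)
    (P : PrincipalBundle O 𝔤 Γ) : Represents P (P.orbibundle hO : Orbibundle O 𝔤 Γ F) :=
  fun _ _ _ l m w ξ => P.totalπ_smul hO l m w ξ

theorem PrincipalBundle.continuous_ρ (P : PrincipalBundle O 𝔤 Γ) {p q : X} {W : UnifSys n X}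
    (l : Injection W (O.chart p)) (m : Injection W (O.chart q)) :
    Continuous fun w => P.ρ (Arrow.mk l w m) :=
  (P.smooth p q W l m).continuous

namespace Represents

variable {P P' : PrincipalBundle O 𝔤 Γ} {B B' : Orbibundle O 𝔤 Γ F}

/-- In each clause the two sides are fibre coordinates of one map to `E`, and such coordinates are
unique. -/
theorem corresponds [T2Space Γ] [FaithfulSMul Γ F] [LieGroup 𝓘(ℝ, 𝔤) ∞ Γ] (hO : O.Reduced)
    (h : Represents P B) : Corresponds P B := by
  refine ⟨fun p x g => ?_, fun p q W c l₁ l₂ w => ?_⟩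
  · refine congrFun ((B.sys p).eq_of_π_eq (hO p) (Injection.act _ g)
      (P.continuous_ρ (Injection.refl _) (Injection.act _ g))
      ((B.sys p).smooth_ρ g).continuous fun x ξ => ?_) x
    exact (h p p _ (Injection.refl _) (Injection.act _ g) x ξ).trans
      ((B.sys p).π_smul g x ξ).symm
  · refine congrFun ((B.sys q).eq_of_π_eq (hO q) l₂.toInjection
      (θ := fun w => P.ρ (Arrow.mk l₁.toInjection w l₂.toInjection) * l₁.θ w) (θ' := l₂.θ)
      ((P.smooth p q W _ _).mul l₁.smooth_θ).continuous l₂.smooth_θ.continuous fun x ξ => ?_) w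
    rw [mul_smul, h, l₁.π_lift, l₂.π_lift]

theorem of_same (h : Represents P B) (hB : B.Same B') : Represents P B' := by
  obtain ⟨f, -, -, hf⟩ := hB
  intro p q W l m w ξ
  rw [hf, hf, h]

theorem unique [T2Space Γ] [FaithfulSMul Γ F] (hO : O.Reduced) (h : Represents P B)
    (h' : Represents P' B) : P = P' := by
  refine PrincipalBundle.ext (funext ?_)
  rintro ⟨p, q, W, l, w, m⟩
  exact congrFun ((B.sys q).eq_of_π_eq (hO q) m (P.continuous_ρ l m) (P'.continuous_ρ l m)
    fun x ξ => (h p q W l m x ξ).trans (h' p q W l m x ξ).symm) w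

/-- Points of the products `V_p × F` have the same image in the total space if and only if they are
identified by an arrow. -/
theorem π_eq_iff [T2Space Γ] [FaithfulSMul Γ F] [LieGroup 𝓘(ℝ, 𝔤) ∞ Γ] (hO : O.Reduced) (h : Represents P B) {p q : X} {x : (O.chart p).V}
    {y : (O.chart q).V} {ξ η : F} :
    (B.sys p).π (x, ξ) = (B.sys q).π (y, η) ↔
      ∃ (W : UnifSys n X) (l : Injection W (O.chart p)) (m : Injection W (O.chart q)) (w : W.V),
        l.toFun w = x ∧ m.toFun w = y ∧ η = P.ρ (Arrow.mk l w m) • ξ := by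
  constructor
  · intro e
    have hxy : (O.chart p).π x = (O.chart q).π y := by
      rw [← (B.sys p).pr_π (x, ξ), e, (B.sys q).pr_π]
    obtain ⟨W, l, m, w, rfl, rfl⟩ := exists_arrow hO hxy
    rw [← h p q W l m w ξ] at e
    obtain ⟨g, hg, hη⟩ := (B.sys q).π_eq_iff.1 e
    -- An arrow joining the base points may miss the fibre coordinate by a group element `g` of the
    -- chart at `q`; composing with the arrow of `g` corrects this.
    have hmul := P.ρ_mul _ _ _ (Arrow.IsMul.mk l m (Injection.refl _) (Injection.act _ g)
      (Injection.refl _) m w rfl)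
    refine ⟨W, l, (Injection.act _ g).comp m, w, rfl, hg.symm, ?_⟩
    rw [hη, ← (h.corresponds hO).1, smul_smul]
    exact congrArg (· • ξ) hmul.symm
  · rintro ⟨W, l, m, w, rfl, rfl, rfl⟩
    exact (h p q W l m w ξ).symm

/-- A coordinate change between two cocycles induces a map of the orbibundles. -/
theorem exists_continuous_map [T2Space Γ] [FaithfulSMul Γ F] [LieGroup 𝓘(ℝ, 𝔤) ∞ Γ]
    [ContinuousSMul Γ F] (hO : O.Reduced) (h : Represents P B) (h' : Represents P' B')
    {δ : ∀ p, (O.chart p).V → Γ} (hδ : ∀ p, Continuous (δ p))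
    (hρ : ∀ (p q : X) (W : UnifSys n X) (l : Injection W (O.chart p))
      (m : Injection W (O.chart q)) (w : W.V),
      δ q (m.toFun w) * P.ρ (Arrow.mk l w m) = P'.ρ (Arrow.mk l w m) * δ p (l.toFun w)) :
    ∃ f : B.E → B'.E, Continuous f ∧
      ∀ p x (ξ : F), f ((B.sys p).π (x, ξ)) = (B'.sys p).π (x, δ p x • ξ) := by
  let Q : (Σ p : X, (O.chart p).V × F) → B.E := fun y => (B.sys y.1).π y.2
  let R : (Σ p : X, (O.chart p).V × F) → B'.E := fun y =>
    (B'.sys y.1).π (y.2.1, δ y.1 y.2.1 • y.2.2)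
  have hQs : Function.Surjective Q := by
    intro e
    have : e ∈ Set.range (B.sys (B.pr e)).π := by
      rw [(B.sys (B.pr e)).range_π]
      exact O.mem_chart (B.pr e)
    obtain ⟨y, hy⟩ := this
    exact ⟨⟨_, y⟩, hy⟩
  -- The space `B.E` is a quotient of the disjoint union of the products, so a continuous map out of
  -- it may be defined on the pieces.
  have hQ : IsQuotientMap Q := IsOpenMap.isQuotientMap
    (isOpenMap_sigma.2 fun p => (B.sys p).isOpenMap_π)
    (continuous_sigma fun p => (B.sys p).continuous_π) hQs
  have hR : Continuous R := continuous_sigma fun p => (B'.sys p).continuous_π.comp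
    (continuous_fst.prodMk (((hδ p).comp continuous_fst).smul continuous_snd))
  have hQR : ∀ a b, Q a = Q b → R a = R b := by
    rintro ⟨p, x, ξ⟩ ⟨q, y, η⟩ e
    change (B.sys p).π (x, ξ) = (B.sys q).π (y, η) at e
    obtain ⟨W, l, m, w, rfl, rfl, rfl⟩ := (h.π_eq_iff hO).1 e
    refine (h'.π_eq_iff hO).2 ⟨W, l, m, w, rfl, rfl, ?_⟩
    rw [smul_smul, smul_smul, hρ]
  let f : B.E → B'.E := fun e => R (Function.surjInv hQs e)
  have hf : ∀ a, f (Q a) = R a := fun a => hQR _ _ (Function.surjInv_eq hQs (Q a))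
  exact ⟨f, hQ.continuous_iff.2 ((funext hf : f ∘ Q = R) ▸ hR), fun p x ξ => hf ⟨p, x, ξ⟩⟩

theorem exists_homeomorph [T2Space Γ] [FaithfulSMul Γ F] [LieGroup 𝓘(ℝ, 𝔤) ∞ Γ]
    [ContinuousSMul Γ F] (hO : O.Reduced) (h : Represents P B) (h' : Represents P' B')
    {δ : ∀ p, (O.chart p).V → Γ} (hδ : ∀ p, ContMDiff (𝓡 n) 𝓘(ℝ, 𝔤) ∞ (δ p))
    (hρ : ∀ (p q : X) (W : UnifSys n X) (l : Injection W (O.chart p))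
      (m : Injection W (O.chart q)) (w : W.V),
      δ q (m.toFun w) * P.ρ (Arrow.mk l w m) = P'.ρ (Arrow.mk l w m) * δ p (l.toFun w)) :
    ∃ f : B.E ≃ₜ B'.E, (∀ e, B'.pr (f e) = B.pr e) ∧
      ∀ p x (ξ : F), f ((B.sys p).π (x, ξ)) = (B'.sys p).π (x, δ p x • ξ) := by
  obtain ⟨f, hfc, hf⟩ := exists_continuous_map hO h h' (fun p => (hδ p).continuous) hρ
  -- The inverse map comes from the pointwise inverse of `δ`, which relates the cocycles in the
  -- opposite direction.
  obtain ⟨f', hfc', hf'⟩ := exists_continuous_map hO h' h (δ := fun p x => (δ p x)⁻¹)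
    (fun p => (hδ p).inv.continuous) fun p q W l m w => by
      rw [inv_mul_eq_iff_eq_mul, ← mul_assoc, hρ, mul_inv_cancel_right]
  have hs : ∀ {B : Orbibundle O 𝔤 Γ F} (e : B.E), ∃ p x ξ, (B.sys p).π (x, ξ) = e := by
    intro B e
    have : e ∈ Set.range (B.sys (B.pr e)).π := by
      rw [(B.sys (B.pr e)).range_π]
      exact O.mem_chart (B.pr e)
    obtain ⟨y, hy⟩ := this
    exact ⟨_, y.1, y.2, hy⟩
  refine ⟨{ toFun := f, invFun := f', left_inv := fun e => ?_, right_inv := fun e => ?_,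
            continuous_toFun := hfc, continuous_invFun := hfc' }, fun e => ?_, hf⟩
  · obtain ⟨p, x, ξ, rfl⟩ := hs e
    rw [hf, hf', inv_smul_smul]
  · obtain ⟨p, x, ξ, rfl⟩ := hs e
    rw [hf', hf, smul_inv_smul]
  · obtain ⟨p, x, ξ, rfl⟩ := hs e
    change B'.pr (f _) = _
    rw [hf, (B'.sys p).pr_π, (B.sys p).pr_π]

/-- With `δ = 1` the homeomorphism matches the chart maps exactly, and both local cocycles are read
off from `P`. -/
theorem same [T2Space Γ] [FaithfulSMul Γ F] [LieGroup 𝓘(ℝ, 𝔤) ∞ Γ] [ContinuousSMul Γ F]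
    (hO : O.Reduced) (h : Represents P B) (h' : Represents P B') : B.Same B' := by
  obtain ⟨f, hf, hfπ⟩ := exists_homeomorph hO h h' (δ := fun _ _ => 1)
    (fun _ => contMDiff_const) (by simp)
  refine ⟨f, hf, fun p x g => ?_, fun p y => ?_⟩
  · rw [← (h.corresponds hO).1, ← (h'.corresponds hO).1]
  · simpa using (hfπ p y.1 y.2).symm

theorem isomorphic_of_isomorphic [T2Space Γ] [FaithfulSMul Γ F] [LieGroup 𝓘(ℝ, 𝔤) ∞ Γ]
    [ContinuousSMul Γ F] (hO : O.Reduced) (h : Represents P B) (h' : Represents P' B')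
    (hP : P.Isomorphic P') : B.Isomorphic B' := by
  obtain ⟨δ, hδ, hδe, hδρ⟩ := hP
  have hs : ∀ p, ContMDiff (𝓡 n) 𝓘(ℝ, 𝔤) ∞ fun x : (O.chart p).V => δ (Arrow.e ⟨p, x⟩) :=
    fun p => hδ p p _ (Injection.refl _) (Injection.refl _)
  obtain ⟨f, hf, hfπ⟩ := exists_homeomorph hO h h' hs fun p q W l m w => by
    have := hδρ (Arrow.mk l w m)
    -- The value of `δ` on an arrow depends only on its source, so on the inverse arrow it is the
    -- value at the target.
    rwa [hδe (Arrow.mk l w m), hδe (Arrow.mk l w m).i] at this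
  refine ⟨f, hf, fun p => ⟨O.chart p, B.sys p, (B.sys p).map f hf, O.mem_chart p,
    fun _ _ => rfl, fun _ => rfl, ⟨.ofReduced (hO p) (Injection.refl _) (fun _ => 1)
      contMDiff_const fun x ξ => ?_⟩, ⟨.ofReduced (hO p) (Injection.refl _) _ (hs p)
      fun x ξ => (hfπ p x ξ).symm⟩⟩⟩
  rw [one_smul]; rfl

theorem isomorphic_of_orbibundle_isomorphic [T2Space Γ] [FaithfulSMul Γ F]
    [LieGroup 𝓘(ℝ, 𝔤) ∞ Γ] (hO : O.Reduced) (h : Represents P B)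
    (h' : Represents P' B') (hB : B.Isomorphic B') : P.Isomorphic P' := by
  obtain ⟨f, hf, hfB⟩ := hB
  have hag : ∀ p, Agree ((B.sys p).map f hf) (B'.sys p) (Injection.refl _)
      (Injection.refl _) := by
    refine fun p => Agree.of_locally (hO p) fun x => ?_
    obtain ⟨W, c, c', ⟨w, hw⟩, -, hc, ⟨i⟩, ⟨j⟩⟩ := hfB ((O.chart p).π x)
    obtain ⟨Z, k, k', z, hk, hk'⟩ := exists_arrow hO (x := x) (y := i.toInjection.toFun w)
      (by rw [i.π_toFun, hw])
    obtain ⟨Y, a, b, y, e, ha, -⟩ := Injection.exists_refinement (hO _) k' i.toInjection hk'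
    refine ⟨Y, k.comp a, y, ?_, ?_⟩
    · rw [← hk, ← ha]; rfl
    -- The chain runs from the chart at `p` to the chart at the base point of `x` and to the germ
    -- `c` there, across `f` to `c'`, then back to the chart at `p` on the side of `B'`.
    · have s₁ := (B.agree hO (k.comp a) (k'.comp a)).map f hf
      have s₂ := (Agree.of_bundleInj i b).symm.map f hf
      have s₃ : Agree (c.map f hf) c' b b :=
        ⟨fun _ => 1, contMDiff_const, fun x ξ => by rw [one_smul, hc]; rfl⟩
      have s₄ := Agree.of_bundleInj j b
      have s₅ := B'.agree hO (j.toInjection.comp b) (k.comp a)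
      rw [← e] at s₂
      exact s₁.trans (s₂.trans (s₃.trans (s₄.trans s₅)))
  choose δ hδ hδπ using hag
  refine ⟨fun r => δ r.s.1 r.s.2, fun p q W l m => (hδ p).comp l.contMDiff, fun r => rfl, ?_⟩
  rintro ⟨p, q, W, l, w, m⟩
  -- Both sides are coordinates of `f` from the chart at `p` to the chart at `q`, changing charts
  -- before or after applying `f`.
  refine congrFun ((B'.sys q).eq_of_π_eq (hO q) m
    (θ := fun w => δ q (m.toFun w) * P.ρ (Arrow.mk l w m))
    (θ' := fun w => P'.ρ (Arrow.mk l w m) * δ p (l.toFun w)) ?_ ?_ fun x ξ => ?_) w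
  · exact (((hδ q).comp m.contMDiff).mul (P.smooth p q W l m)).continuous
  · exact ((P'.smooth p q W l m).mul ((hδ p).comp l.contMDiff)).continuous
  · rw [mul_smul, mul_smul, h']
    refine (hδπ q (m.toFun x) _).trans (Eq.trans ?_ (hδπ p (l.toFun x) ξ).symm)
    exact congrArg f (h p q W l m x ξ)

end Represents

/-- The cocycle of an orbibundle. -/
theorem Orbibundle.exists_represents [T2Space Γ] [FaithfulSMul Γ F] [LieGroup 𝓘(ℝ, 𝔤) ∞ Γ]
    (hO : O.Reduced) (B : Orbibundle O 𝔤 Γ F) :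
    ∃ P : PrincipalBundle O 𝔤 Γ, Represents P B := by
  -- The choice is harmless: coordinate changes are unique, which also makes them descend to arrows
  -- and satisfy the laws for inverses and products.
  choose θ hθ h using fun (p q : X) (W : UnifSys n X) (l : Injection W (O.chart p))
    (m : Injection W (O.chart q)) => B.agree hO l m
  have hc := fun p q W l m => (hθ p q W l m).continuous
  refine ⟨{
    ρ := Quot.lift (fun T => θ T.src T.tgt T.W T.left T.right T.pt) ?_
    smooth := fun p q W l m => hθ p q W l m
    ρ_inv := ?_
    ρ_mul := ?_ }, fun p q W l m w ξ => h p q W l m w ξ⟩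
  · rintro _ _ ⟨l, m, f, w⟩
    refine congrFun ((B.sys _).eq_of_π_eq (hO _) (m.comp f) (hc _ _ _ _ _)
      ((hc _ _ _ l m).comp f.continuous) fun x ξ => ?_) w
    exact (h _ _ _ (l.comp f) (m.comp f) x ξ).trans (h _ _ _ l m (f.toFun x) ξ).symm
  · rintro ⟨p, q, W, l, w, m⟩
    refine congrFun ((B.sys p).eq_of_π_eq (hO p) l (hc q p W m l)
      (θ' := fun w => (θ p q W l m w)⁻¹) (hθ p q W l m).inv.continuous fun x ξ => ?_) w
    rw [h, ← h p q W l m, smul_inv_smul]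
  · rintro _ _ _ ⟨l₁, l₂, m₁, m₂, f, g, y, e⟩
    refine congrFun ((B.sys _).eq_of_π_eq (hO _) (m₂.comp g) (hc _ _ _ (l₁.comp f) (m₂.comp g))
      (((hθ _ _ _ m₁ m₂).comp g.contMDiff).mul ((hθ _ _ _ l₁ l₂).comp f.contMDiff)).continuous
      fun x ξ => ?_) y
    have he : l₂.toFun (f.toFun x) = m₁.toFun (g.toFun x) :=
      congrFun (congrArg Injection.toFun e) x
    rw [h]
    have h1 := h _ _ _ l₁ l₂ (f.toFun x) ξ
    have h2 := h _ _ _ m₁ m₂ (g.toFun x) (θ _ _ _ l₁ l₂ (f.toFun x) • ξ)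
    rw [← he, h1, smul_smul] at h2
    exact h2.symm

end Represents

end Orbi

/-! ### The bijection between cocycles and orbibundles -/

theorem mainTheorem10
    {n : ℕ} {X : Type*} [TopologicalSpace X] [T2Space X] [SecondCountableTopology X]
    (O : Orbi.Orbifold n X) (hO : O.Reduced)
    {𝔤 : Type*} [NormedAddCommGroup 𝔤] [NormedSpace ℝ 𝔤]
    {Γ : Type*} [TopologicalSpace Γ] [T2Space Γ] [ChartedSpace 𝔤 Γ] [Group Γ]
    [LieGroup 𝓘(ℝ, 𝔤) ∞ Γ]
    {EF : Type*} [NormedAddCommGroup EF] [NormedSpace ℝ EF]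
    {F : Type*} [TopologicalSpace F] [ChartedSpace EF F] [IsManifold 𝓘(ℝ, EF) ∞ F] [Nonempty F]
    [MulAction Γ F] [FaithfulSMul Γ F]
    (hF : ContMDiff (𝓘(ℝ, 𝔤).prod 𝓘(ℝ, EF)) 𝓘(ℝ, EF) ∞ (fun y : Γ × F => y.1 • y.2)) :
    ∃ Φ : Orbi.PrincipalBundle O 𝔤 Γ ≃ Quotient (Orbi.Orbibundle.sameSetoid O 𝔤 Γ F),
      (∀ (P : Orbi.PrincipalBundle O 𝔤 Γ) (B : Orbi.Orbibundle O 𝔤 Γ F),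
        Φ P = Quotient.mk _ B → Orbi.Corresponds P B) ∧
      ∀ (P P' : Orbi.PrincipalBundle O 𝔤 Γ) (B B' : Orbi.Orbibundle O 𝔤 Γ F),
        Φ P = Quotient.mk _ B → Φ P' = Quotient.mk _ B' →
          (P.Isomorphic P' ↔ B.Isomorphic B') := by
  have : ContinuousSMul Γ F := ⟨hF.continuous⟩
  let φ : Orbi.PrincipalBundle O 𝔤 Γ → Quotient (Orbi.Orbibundle.sameSetoid O 𝔤 Γ F) :=
    fun P => Quotient.mk _ (P.orbibundle hO)
  -- `Represents` is invariant under `Same`, so it holds for every representative of the class, not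
  -- only for the glued space.
  have key : ∀ (P : Orbi.PrincipalBundle O 𝔤 Γ) (B : Orbi.Orbibundle O 𝔤 Γ F),
      φ P = Quotient.mk _ B → Orbi.Represents P B := fun P B h =>
    (P.represents_orbibundle hO).of_same (Quotient.exact h)
  have hφ : Function.Bijective φ := by
    refine ⟨fun P P' h => (key P _ h).unique hO (P'.represents_orbibundle hO), ?_⟩
    rintro ⟨B⟩
    obtain ⟨P, hP⟩ := B.exists_represents hO
    exact ⟨P, Quotient.sound ((P.represents_orbibundle hO).same hO hP)⟩
  exact ⟨Equiv.ofBijective φ hφ, fun P B h => (key P B h).corresponds hO,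
    fun P P' B B' h h' => ⟨(key P B h).isomorphic_of_isomorphic hO (key P' B' h'),
      (key P B h).isomorphic_of_orbibundle_isomorphic hO (key P' B' h')⟩⟩
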